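/- Consider $M\ge 1$ followers, labelled $\mathcal F=\{1,\dots,M\}$, and $N-M\ge 1$ leaders, labelled $\mathcal L=\{M+1,\dots,N\}$. The leaders satisfy $\dot x_k=Sx_k$, $z_k=Rx_k$, with $x_k(t)\in\mathbb R^r$, $z_k(t)\in\mathbb R^p$, and the followers satisfy $$\dot x_i=A_ix_i+B_iu_i+E_id_i,\qquad y_i=C_{1i}x_i+D_{1i}d_i,\qquad z_i=C_{2i}x_i+D_{2i}u_i,$$ with $x_i\in\mathbb R^{n_i}$, $u_i\in\mathbb R^{m_i}$, $d_i\in\mathbb R^{q_i}$, $y_i\in\mathbb R^{r_i}$, $z_i\in\mathbb R^p$, where all matrices are real. The communication graph on $\{1,\dots,N\}$ is directed; put $a_{ij}=1$ if $i\ne j$ and there is an edge from $j$ to $i$, and $a_{ij}=0$ otherwise. No leader receives an edge from a follower, every leader has an edge to at least one follower, and the graph between the followers is simple, undirected and connected. Let $L_{ii}=\sum_j a_{ij}$, $L_{ij}=-a_{ij}$ ($i\neq j$) define the Laplacian, let $L_1\in\mathbb R^{M\times M}$ and $L_2\in\mathbb R^{M\times(N-M)}$ be its follower–follower and follower–leader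 blocks, and let $\lambda_M$ be the largest eigenvalue of $L_1$. Assume that every pair $(A_i,B_i)$ is stabilizable, every pair $(C_{1i},A_i)$ is detectable, $(R,S)$ is observable, all eigenvalues of $S$ lie on the imaginary axis, and that $\Pi_i\in\mathbb R^{n_i\times r}$, $\Gamma_i\in\mathbb R^{m_i\times r}$ solve the regulator equations $A_i\Pi_i+B_i\Gamma_i=\Pi_iS$, $C_{2i}\Pi_i+D_{2i}\Gamma_i=R$ for all $i\in\mathcal F$. The agents are interconnected by the protocol $$\dot w_i=A_iw_i+B_iu_i+G_i(C_{1i}w_i-y_i),\quad \dot v_i=Sv_i+\sum_{j=1}^Ma_{ij}(v_j-v_i)+\sum_{j=M+1}^Na_{ij}(x_j-v_i),\quad u_i=F_i(w_i-\Pi_iv_i)+\Gamma_iv_i ,\qquad i\in\mathcal F.$$ It achieves output containment control if, whenever all $d_i=0$, along every solution of the interconnected system on $[0,\infty)$ one has, as $t\to\infty$, $$\mathbf z_f(t)-(-L_1^{-1}L_2\otimes I_p)\mathbf z_l(t)\to0,\qquad \mathbf w_f(t)-\mathbf x_f(t)\to0,\qquad \mathbf v_f(t)-(-L_1^{-1}L_2\otimes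 I_r)\mathbf x_l(t)\to0 ,$$ where bold letters denote the stacked vectors of the followers ($f$) and of the leaders ($l$). With $A,B,C_1,C_2,D_1,D_2,E,F,G,\Pi$ the block diagonal matrices with blocks $A_i,B_i,C_{1i},C_{2i},D_{1i},D_{2i},E_i,F_i,G_i,\Pi_i$, put $$A_o=\begin{bmatrix}A+GC_1&0&0\\-BF&A+BF&\Pi\\0&0&I_M\otimes S-L_1\otimes I_r\end{bmatrix},\qquad E_o=\begin{bmatrix}E+GD_1\\E\\0\end{bmatrix},$$ $$C_o=\begin{bmatrix}-(L_1\otimes I_p)D_2F&(L_1\otimes I_p)(C_2+D_2F)&I_M\otimes R\end{bmatrix},$$ so that $T_{F,G}(t)=C_oe^{A_ot}E_o$ is the impulse response from the disturbance to the performance output $\epsilon_i=\sum_{j=1}^N a_{ij}(z_i-z_j)$, $i\in\mathcal F$, and let $J(F,G)=\int_0^\infty\operatorname{tr}\big[T_{F,G}(t)^\top T_{F,G}(t)\big]\,dt$. **Theorem 4.** Let $\gamma>0$ and assume that for all $i\in\mathcal F$: $D_{1i}E_i^\top=0$, $D_{2i}^\top C_{2i}=0$, $D_{1i}D_{1i}^\top=I$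 and $D_{2i}^\top D_{2i}=I$. Suppose that for every $i\in\mathcal F$ there are symmetric matrices $P_i>0$, $Q_i>0$ with $$A_i^\top P_i+P_iA_i-P_iB_iB_i^\top P_i+C_{2i}^\top C_{2i}<0,\qquad A_iQ_i+Q_iA_i^\top-Q_iC_{1i}^\top C_{1i}Q_i+E_iE_i^\top<0,$$ $$\operatorname{tr}(C_{1i}Q_iP_iQ_iC_{1i}^\top)+\operatorname{tr}(C_{2i}Q_iC_{2i}^\top)<\frac{\gamma}{M\lambda_M^2}.$$ Then the protocol with $F_i=-B_i^\top P_i$ and $G_i=-Q_iC_{1i}^\top$ achieves output containment control, and the integral $J(F,G)$ converges with $J(F,G)<\gamma$. -/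

import Mathlib

open Matrix Filter Topology MeasureTheory
open scoped Kronecker

namespace Containment

noncomputable section

/-! ### Linear systems notions -/

/-- A real square matrix is Hurwitz if all its (complex) eigenvalues have negative real part. -/
def IsHurwitz {n : ℕ} (A : Matrix (Fin n) (Fin n) ℝ) : Prop :=
  ∀ μ ∈ spectrum ℂ (A.map (algebraMap ℝ ℂ)), μ.re < 0

/-- All (complex) eigenvalues of the real matrix `S` lie on the imaginary axis. -/
def EigenvaluesImaginary {n : ℕ} (S : Matrix (Fin n) (Fin n) ℝ) : Prop :=
  ∀ μ ∈ spectrum ℂ (S.map (algebraMap ℝ ℂ)), μ.re = 0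

/-- The pair `(A, B)` is stabilizable. -/
def Stabilizable {n m : ℕ} (A : Matrix (Fin n) (Fin n) ℝ) (B : Matrix (Fin n) (Fin m) ℝ) : Prop :=
  ∃ F : Matrix (Fin m) (Fin n) ℝ, IsHurwitz (A + B * F)

/-- The pair `(C, A)` is detectable. -/
def Detectable {n s : ℕ} (C : Matrix (Fin s) (Fin n) ℝ) (A : Matrix (Fin n) (Fin n) ℝ) : Prop :=
  ∃ G : Matrix (Fin n) (Fin s) ℝ, IsHurwitz (A + G * C)

/-- The pair `(C, A)` is observable: the kernel of the observability matrix is zero. -/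
def Observable {n p : ℕ} (C : Matrix (Fin p) (Fin n) ℝ) (A : Matrix (Fin n) (Fin n) ℝ) : Prop :=
  ∀ x : Fin n → ℝ, (∀ k : ℕ, (C * A ^ k) *ᵥ x = 0) → x = 0

/-- A symmetric matrix `X` is negative definite, `X < 0`. -/
def NegDef {n : ℕ} (X : Matrix (Fin n) (Fin n) ℝ) : Prop := (-X).PosDef

/-! ### The communication graph -/

/-- The agents: `M` followers (`Sum.inl`) and `K` leaders (`Sum.inr`). -/
abbrev Agent (M K : ℕ) : Type := Fin M ⊕ Fin K

/-- Adjacency matrix: the `(i, j)` entry is `1` if there is an edge from `j` to `i ≠ j`,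
and `0` otherwise. -/
def adjacency {V : Type} (G : Digraph V) : Matrix V V ℝ := by
  classical exact fun i j => if i ≠ j ∧ G.Adj j i then 1 else 0

/-- Laplacian matrix: degree matrix minus adjacency matrix. -/
def laplacian {V : Type} [Fintype V] [DecidableEq V] (G : Digraph V) : Matrix V V ℝ :=
  Matrix.diagonal (fun i => ∑ j, adjacency G i j) - adjacency G

/-- The follower-follower block of the Laplacian. -/
def L₁ {M K : ℕ} (G : Digraph (Agent M K)) : Matrix (Fin M) (Fin M) ℝ :=
  (laplacian G).toBlocks₁₁

/-- The follower-leader block of the Laplacian. -/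
def L₂ {M K : ℕ} (G : Digraph (Agent M K)) : Matrix (Fin M) (Fin K) ℝ :=
  (laplacian G).toBlocks₁₂

/-- Standing assumption on the communication graph. -/
structure GraphAssumption {M K : ℕ} (G : Digraph (Agent M K)) : Prop where
  /-- The leaders receive no information from any follower. -/
  leaders_receive_nothing : ∀ (i : Fin M) (k : Fin K), ¬ G.Adj (Sum.inl i) (Sum.inr k)
  /-- Each leader shares its information with at least one follower. -/
  leaders_share : ∀ k : Fin K, ∃ i : Fin M, G.Adj (Sum.inr k) (Sum.inl i)
  /-- The graph between the followers is undirected. -/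
  followers_undirected : ∀ i j : Fin M,
    G.Adj (Sum.inl i) (Sum.inl j) → G.Adj (Sum.inl j) (Sum.inl i)
  /-- The graph between the followers is simple. -/
  followers_simple : ∀ i : Fin M, ¬ G.Adj (Sum.inl i) (Sum.inl i)
  /-- The graph between the followers is connected. -/
  followers_connected :
    (SimpleGraph.fromRel fun i j : Fin M => G.Adj (Sum.inl i) (Sum.inl j)).Connected

/-! ### Agents, protocol, closed-loop trajectories -/

/-- Data of a follower `x' = A x + B u + E d`, `y = C1 x + D1 d`, `z = C2 x + D2 u`, with
`x ∈ ℝⁿ`, `u ∈ ℝᵐ`, `d ∈ ℝ^q`, `y ∈ ℝˢ`, `z ∈ ℝᵖ`. -/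
structure Follower (n m q s p : ℕ) where
  A : Matrix (Fin n) (Fin n) ℝ
  B : Matrix (Fin n) (Fin m) ℝ
  E : Matrix (Fin n) (Fin q) ℝ
  C1 : Matrix (Fin s) (Fin n) ℝ
  D1 : Matrix (Fin s) (Fin q) ℝ
  C2 : Matrix (Fin p) (Fin n) ℝ
  D2 : Matrix (Fin p) (Fin m) ℝ

/-- Data of a heterogeneous multi-agent system with `M` followers and `K` leaders
`x' = S x`, `z = R x`, where `x ∈ ℝʳ`, `z ∈ ℝᵖ`. -/
structure MultiAgent (M K r p : ℕ) (n m q s : Fin M → ℕ) where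
  graph : Digraph (Agent M K)
  S : Matrix (Fin r) (Fin r) ℝ
  R : Matrix (Fin p) (Fin r) ℝ
  fol : ∀ i : Fin M, Follower (n i) (m i) (q i) (s i) p

/-- The matrices of the distributed protocol. -/
structure Protocol (M r : ℕ) (n m s : Fin M → ℕ) where
  F : ∀ i : Fin M, Matrix (Fin (m i)) (Fin (n i)) ℝ
  G : ∀ i : Fin M, Matrix (Fin (n i)) (Fin (s i)) ℝ
  Pi : ∀ i : Fin M, Matrix (Fin (n i)) (Fin r) ℝ
  Gam : ∀ i : Fin M, Matrix (Fin (m i)) (Fin r) ℝ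

variable {M K r p : ℕ} {n m q s : Fin M → ℕ}

/-- The standing assumptions on a multi-agent system. -/
structure StandingAssumption (𝒩 : MultiAgent M K r p n m q s) : Prop where
  graph : GraphAssumption 𝒩.graph
  stabilizable : ∀ i, Stabilizable (𝒩.fol i).A (𝒩.fol i).B
  detectable : ∀ i, Detectable (𝒩.fol i).C1 (𝒩.fol i).A
  observable : Observable 𝒩.R 𝒩.S
  imaginary : EigenvaluesImaginary 𝒩.S

/-- `Pi i`, `Gam i` solve the regulator equations of follower `i`, for every `i`. -/
def RegulatorEquations (𝒩 : MultiAgent M K r p n m q s)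
    (Pi : ∀ i : Fin M, Matrix (Fin (n i)) (Fin r) ℝ)
    (Gam : ∀ i : Fin M, Matrix (Fin (m i)) (Fin r) ℝ) : Prop :=
  ∀ i, (𝒩.fol i).A * Pi i + (𝒩.fol i).B * Gam i = Pi i * 𝒩.S ∧
    (𝒩.fol i).C2 * Pi i + (𝒩.fol i).D2 * Gam i = 𝒩.R

/-- The protocol with regulator solutions `Pi`, `Gam` and gains `F_i = -B_iᵀ P_i`,
`G_i = -Q_i C_{1i}ᵀ`. -/
def riccatiProtocol (𝒩 : MultiAgent M K r p n m q s)
    (Pi : ∀ i : Fin M, Matrix (Fin (n i)) (Fin r) ℝ)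
    (Gam : ∀ i : Fin M, Matrix (Fin (m i)) (Fin r) ℝ)
    (P Q : ∀ i : Fin M, Matrix (Fin (n i)) (Fin (n i)) ℝ) : Protocol M r n m s where
  F := fun i => -((𝒩.fol i).Bᵀ * P i)
  G := fun i => -(Q i * (𝒩.fol i).C1ᵀ)
  Pi := Pi
  Gam := Gam

/-- Time signals: follower states `xf`, leader states `xl`, observer states `w`,
and states `v` of the auxiliary reference systems. -/
structure Signals (M K r : ℕ) (n : Fin M → ℕ) where
  xf : ∀ i : Fin M, ℝ → (Fin (n i) → ℝ)
  xl : Fin K → ℝ → (Fin r → ℝ)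
  w : ∀ i : Fin M, ℝ → (Fin (n i) → ℝ)
  v : Fin M → ℝ → (Fin r → ℝ)

/-- The input `u_i = F_i (w_i - Π_i v_i) + Γ_i v_i`. -/
def Signals.u (σ : Signals M K r n) (pr : Protocol M r n m s) (i : Fin M) (t : ℝ) :
    Fin (m i) → ℝ :=
  pr.F i *ᵥ (σ.w i t - pr.Pi i *ᵥ σ.v i t) + pr.Gam i *ᵥ σ.v i t

/-- The measured output `y_i = C_{1i} x_i + D_{1i} d_i`. -/
def Signals.y (σ : Signals M K r n) (𝒩 : MultiAgent M K r p n m q s)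
    (d : ∀ i : Fin M, ℝ → (Fin (q i) → ℝ)) (i : Fin M) (t : ℝ) : Fin (s i) → ℝ :=
  (𝒩.fol i).C1 *ᵥ σ.xf i t + (𝒩.fol i).D1 *ᵥ d i t

/-- The controlled output `z_i = C_{2i} x_i + D_{2i} u_i` of a follower. -/
def Signals.zf (σ : Signals M K r n) (𝒩 : MultiAgent M K r p n m q s)
    (pr : Protocol M r n m s) (i : Fin M) (t : ℝ) : Fin p → ℝ :=
  (𝒩.fol i).C2 *ᵥ σ.xf i t + (𝒩.fol i).D2 *ᵥ σ.u pr i t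

/-- The controlled output `z_k = R x_k` of a leader. -/
def Signals.zl (σ : Signals M K r n) (𝒩 : MultiAgent M K r p n m q s)
    (k : Fin K) (t : ℝ) : Fin p → ℝ :=
  𝒩.R *ᵥ σ.xl k t

/-- The signals form a solution on `[0, ∞)` of the multi-agent system interconnected with the
protocol, under the disturbances `d`. -/
structure IsTrajectory (𝒩 : MultiAgent M K r p n m q s) (pr : Protocol M r n m s)
    (d : ∀ i : Fin M, ℝ → (Fin (q i) → ℝ)) (σ : Signals M K r n) : Prop where
  leader : ∀ k, ∀ t, 0 ≤ t →
    HasDerivWithinAt (σ.xl k) (𝒩.S *ᵥ σ.xl k t) (Set.Ici 0) t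
  follower : ∀ i, ∀ t, 0 ≤ t →
    HasDerivWithinAt (σ.xf i)
      ((𝒩.fol i).A *ᵥ σ.xf i t + (𝒩.fol i).B *ᵥ σ.u pr i t + (𝒩.fol i).E *ᵥ d i t)
      (Set.Ici 0) t
  observer : ∀ i, ∀ t, 0 ≤ t →
    HasDerivWithinAt (σ.w i)
      ((𝒩.fol i).A *ᵥ σ.w i t + (𝒩.fol i).B *ᵥ σ.u pr i t
        + pr.G i *ᵥ ((𝒩.fol i).C1 *ᵥ σ.w i t - σ.y 𝒩 d i t))
      (Set.Ici 0) t
  reference : ∀ i, ∀ t, 0 ≤ t →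
    HasDerivWithinAt (σ.v i)
      (𝒩.S *ᵥ σ.v i t
        + ∑ j : Fin M, adjacency 𝒩.graph (Sum.inl i) (Sum.inl j) • (σ.v j t - σ.v i t)
        + ∑ k : Fin K, adjacency 𝒩.graph (Sum.inl i) (Sum.inr k) • (σ.xl k t - σ.v i t))
      (Set.Ici 0) t

/-- `i`-th block of `(-L₁⁻¹ L₂ ⊗ I) a`, where `a` is the stacked vector of the `a k`. -/
def hullPoint {ℓ : ℕ} (G : Digraph (Agent M K)) (a : Fin K → (Fin ℓ → ℝ)) (i : Fin M) :
    Fin ℓ → ℝ :=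
  ∑ k : Fin K, (-((L₁ G)⁻¹ * L₂ G)) i k • a k

/-- The protocol achieves output containment control: whenever all disturbances vanish,
along every closed-loop trajectory `z_f → ω_z`, `w_f → x_f` and `v_f → ω_v`. -/
def AchievesOutputContainment (𝒩 : MultiAgent M K r p n m q s) (pr : Protocol M r n m s) :
    Prop :=
  ∀ σ : Signals M K r n, IsTrajectory 𝒩 pr (fun _ _ => 0) σ → ∀ i : Fin M,
    Tendsto (fun t => σ.zf 𝒩 pr i t - hullPoint 𝒩.graph (fun k => σ.zl 𝒩 k t) i)
      atTop (𝓝 0) ∧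
    Tendsto (fun t => σ.w i t - σ.xf i t) atTop (𝓝 0) ∧
    Tendsto (fun t => σ.v i t - hullPoint 𝒩.graph (fun k => σ.xl k t) i) atTop (𝓝 0)

/-! ### The controlled error system and its `H₂` cost

Stacked vectors with blocks of sizes `a i` are indexed by `Σ i, Fin (a i)`. -/

/-- Index type of a stacked vector with blocks of sizes `a i`. -/
abbrev Stack {M : ℕ} (a : Fin M → ℕ) : Type := (i : Fin M) × Fin (a i)

/-- `X ⊗ Y`, with rows and columns indexed as stacked vectors. -/
def kron {a b : ℕ} (X : Matrix (Fin M) (Fin M) ℝ) (Y : Matrix (Fin a) (Fin b) ℝ) :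
    Matrix (Stack fun _ : Fin M => a) (Stack fun _ : Fin M => b) ℝ :=
  (X ⊗ₖ Y).submatrix (Equiv.sigmaEquivProd (Fin M) (Fin a)) (Equiv.sigmaEquivProd (Fin M) (Fin b))

/-- State index of the error system with state `(e, δ, ξ)`. -/
abbrev ErrState (r : ℕ) {M : ℕ} (n : Fin M → ℕ) : Type :=
  Stack n ⊕ (Stack n ⊕ Stack fun _ : Fin M => r)

/-- State matrix of the error system:
`[A + G C₁, 0, 0; -B F, A + B F, Π; 0, 0, I ⊗ S - L₁ ⊗ I]`. -/
def errA (𝒩 : MultiAgent M K r p n m q s) (pr : Protocol M r n m s) :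
    Matrix (ErrState r n) (ErrState r n) ℝ :=
  let A := blockDiagonal' fun i => (𝒩.fol i).A
  let B := blockDiagonal' fun i => (𝒩.fol i).B
  let C1 := blockDiagonal' fun i => (𝒩.fol i).C1
  let F := blockDiagonal' pr.F
  let G := blockDiagonal' pr.G
  let Pi := blockDiagonal' pr.Pi
  fromBlocks (A + G * C1) (fromCols 0 0)
    (fromRows (-(B * F)) 0)
    (fromBlocks (A + B * F) Pi 0 (kron 1 𝒩.S - kron (L₁ 𝒩.graph) 1))

/-- Input matrix of the error system: `[E + G D₁; E; 0]`. -/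
def errE (𝒩 : MultiAgent M K r p n m q s) (pr : Protocol M r n m s) :
    Matrix (ErrState r n) (Stack q) ℝ :=
  let E := blockDiagonal' fun i => (𝒩.fol i).E
  let D1 := blockDiagonal' fun i => (𝒩.fol i).D1
  let G := blockDiagonal' pr.G
  fromRows (E + G * D1) (fromRows E 0)

/-- Output matrix of the error system:
`[-(L₁ ⊗ I) D₂ F, (L₁ ⊗ I) (C₂ + D₂ F), I ⊗ R]`. -/
def errC (𝒩 : MultiAgent M K r p n m q s) (pr : Protocol M r n m s) :
    Matrix (Stack fun _ : Fin M => p) (ErrState r n) ℝ :=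
  let C2 := blockDiagonal' fun i => (𝒩.fol i).C2
  let D2 := blockDiagonal' fun i => (𝒩.fol i).D2
  let F := blockDiagonal' pr.F
  let L := kron (L₁ 𝒩.graph) (1 : Matrix (Fin p) (Fin p) ℝ)
  fromCols (-(L * D2 * F)) (fromCols (L * (C2 + D2 * F)) (kron 1 𝒩.R))

/-- Impulse response `T(t) = C_o exp(t A_o) E_o` from the disturbance to `ε`. -/
def impulseResponse (𝒩 : MultiAgent M K r p n m q s) (pr : Protocol M r n m s) (t : ℝ) :
    Matrix (Stack fun _ : Fin M => p) (Stack q) ℝ :=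
  errC 𝒩 pr * NormedSpace.exp (t • errA 𝒩 pr) * errE 𝒩 pr

/-- The integrand `tr (T(t)ᵀ T(t))` of the `H₂` cost. -/
def costDensity (𝒩 : MultiAgent M K r p n m q s) (pr : Protocol M r n m s) (t : ℝ) : ℝ :=
  ((impulseResponse 𝒩 pr t)ᵀ * impulseResponse 𝒩 pr t).trace

/-- The `H₂` cost `J = ∫₀^∞ tr (T(t)ᵀ T(t)) dt`. -/
def cost (𝒩 : MultiAgent M K r p n m q s) (pr : Protocol M r n m s) : ℝ :=
  ∫ t in Set.Ioi (0 : ℝ), costDensity 𝒩 pr t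

end

end Containment

/-! Two facts carry the theorem: the error matrix is asymptotically stable, and each follower has a
storage function whose initial value bounds its share of the cost.

Stability. With `d = 0`, the stack of `x - w`, `x - Π v` and `L₁ v + L₂ x_l` obeys the linear system
with matrix `errA`, whose coupling is triangular. The two Riccati inequalities, rewritten for the
closed loops, are Lyapunov inequalities with `P` and `Q`, so `A + B F` and `A + G C₁` are stable.
The block `I ⊗ S - L₁ ⊗ I` is stable because its eigenvalues are those of `S` shifted left by
eigenvalues of `L₁`, and `L₁` is positive definite. Hence the error state decays
(`negRealParts_errA`), and all three containment limits are linear functions of it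
(`achievesOutputContainment`).

Cost. The trace splits over the columns belonging to each follower `j`. The disturbance of `j`
excites only an `errA`-invariant subspace, described by the filter error `e` and the estimate
coordinate `w - Π v`. There the output is that of follower `j` alone, multiplied by `W`, the `j`-th
block column of `L₁ ⊗ I`, and `Wᵀ W` is the scalar `∑ i, L₁ i j ^ 2` times the identity. Let `N` be
the response to an initial filter error and `Z = exp(t(A + BF)) G`. The storage `tr(N Q Nᵀ) + w
tr(Zᵀ P Z)`, with `w` that scalar, decreases at least at the rate of the cost: completing the square
in the filter inequality leaves the energy of the control output, which the control inequality
absorbs. This is the separation principle in `integral_agent_cost_le`. Its initial value is `w`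
times the trace expression in the hypothesis, and `w ≤ λ_M²` by `sum_sq_col_le`; summing over `M`
followers gives the bound. -/

namespace Containment

/-! ### Entrywise calculus of matrix functions and exponentials. -/

section MatrixCalculus

variable {α β ι κ : Type*}

/-- Entrywise differentiability of a matrix valued function. -/
def HasMatDerivAt (X : ℝ → Matrix α β ℝ) (X' : Matrix α β ℝ) (t : ℝ) : Prop :=
  ∀ i j, HasDerivAt (fun s => X s i j) (X' i j) t

theorem HasMatDerivAt.const (X : Matrix α β ℝ) (t : ℝ) : HasMatDerivAt (fun _ => X) 0 t :=
  fun _ _ => hasDerivAt_const _ _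

theorem HasMatDerivAt.transpose {X : ℝ → Matrix α β ℝ} {X' : Matrix α β ℝ} {t : ℝ}
    (h : HasMatDerivAt X X' t) : HasMatDerivAt (fun s => (X s)ᵀ) X'ᵀ t :=
  fun i j => h j i

theorem HasMatDerivAt.mul [Fintype ι] {X : ℝ → Matrix α ι ℝ} {X' : Matrix α ι ℝ}
    {Y : ℝ → Matrix ι β ℝ} {Y' : Matrix ι β ℝ} {t : ℝ}
    (hX : HasMatDerivAt X X' t) (hY : HasMatDerivAt Y Y' t) :
    HasMatDerivAt (fun s => X s * Y s) (X' * Y t + X t * Y') t := by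
  intro i j
  simp only [Matrix.mul_apply, Matrix.add_apply, ← Finset.sum_add_distrib]
  exact HasDerivAt.fun_sum fun k _ => (hX i k).mul (hY k j)

theorem HasMatDerivAt.mul_const [Fintype ι] {X : ℝ → Matrix α ι ℝ} {X' : Matrix α ι ℝ} {t : ℝ}
    (hX : HasMatDerivAt X X' t) (Y : Matrix ι β ℝ) :
    HasMatDerivAt (fun s => X s * Y) (X' * Y) t := by
  simpa using hX.mul (HasMatDerivAt.const Y t)

theorem HasMatDerivAt.const_mul [Fintype ι] {X : ℝ → Matrix ι β ℝ} {X' : Matrix ι β ℝ} {t : ℝ}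
    (hX : HasMatDerivAt X X' t) (Y : Matrix α ι ℝ) :
    HasMatDerivAt (fun s => Y * X s) (Y * X') t := by
  simpa using (HasMatDerivAt.const Y t).mul hX

theorem HasMatDerivAt.trace [Fintype α] {X : ℝ → Matrix α α ℝ} {X' : Matrix α α ℝ} {t : ℝ}
    (hX : HasMatDerivAt X X' t) : HasDerivAt (fun s => (X s).trace) X'.trace t := by
  simp only [Matrix.trace, Matrix.diag_apply]
  exact HasDerivAt.fun_sum fun k _ => hX k k

variable [Fintype ι] [DecidableEq ι] [Fintype κ] [DecidableEq κ]

attribute [local instance] Matrix.linftyOpNormedRing Matrix.linftyOpNormedAlgebra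

theorem hasMatDerivAt_exp (A : Matrix ι ι ℝ) (t : ℝ) :
    HasMatDerivAt (fun s => NormedSpace.exp (s • A)) (NormedSpace.exp (t • A) * A) t := by
  intro i j
  have h := hasDerivAt_exp_smul_const (𝕂 := ℝ) A t
  let φ : Matrix ι ι ℝ →L[ℝ] ℝ :=
    LinearMap.toContinuousLinearMap (Matrix.entryLinearMap ℝ ℝ i j)
  exact φ.hasFDerivAt.comp_hasDerivAt t h

theorem hasMatDerivAt_exp' (A : Matrix ι ι ℝ) (t : ℝ) :
    HasMatDerivAt (fun s => NormedSpace.exp (s • A)) (A * NormedSpace.exp (t • A)) t := by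
  have h : Commute A (NormedSpace.exp (t • A)) := ((Commute.refl A).smul_right t).exp_right
  rw [h.eq]
  exact hasMatDerivAt_exp A t

theorem exp_neg_smul_mul_exp_smul (A : Matrix ι ι ℝ) (t : ℝ) :
    NormedSpace.exp (-t • A) * NormedSpace.exp (t • A) = 1 := by
  rw [← Matrix.exp_add_of_commute _ _ (((Commute.refl A).smul_left _).smul_right _), ← add_smul]
  simp

theorem exp_smul_mul_exp_neg_smul (A : Matrix ι ι ℝ) (t : ℝ) :
    NormedSpace.exp (t • A) * NormedSpace.exp (-t • A) = 1 := by
  simpa using exp_neg_smul_mul_exp_smul A (-t)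

/-- A rectangular intertwining relation passes to exponentials. -/
theorem exp_smul_mul_of_intertwine {A : Matrix ι ι ℝ} {B : Matrix κ κ ℝ} {X : Matrix ι κ ℝ}
    (h : A * X = X * B) (t : ℝ) :
    NormedSpace.exp (t • A) * X = X * NormedSpace.exp (t • B) := by
  -- The product `exp(sA) X exp(-sB)` has zero derivative, so it keeps its value `X` at `s = 0`.
  have key : ∀ s, HasMatDerivAt
      (fun s => NormedSpace.exp (s • A) * X * NormedSpace.exp (s • -B)) 0 s := by
    intro s
    have := ((hasMatDerivAt_exp A s).mul_const X).mul (hasMatDerivAt_exp' (-B) s)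
    have e : NormedSpace.exp (s • A) * A * X * NormedSpace.exp (s • -B)
        + NormedSpace.exp (s • A) * X * (-B * NormedSpace.exp (s • -B)) = 0 := by
      rw [Matrix.mul_assoc _ A X, h]
      simp [Matrix.mul_assoc]
    rwa [e] at this
  have hc : NormedSpace.exp (t • A) * X * NormedSpace.exp (t • -B) = X := by
    ext i j
    have := is_const_of_deriv_eq_zero
      (f := fun s => (NormedSpace.exp (s • A) * X * NormedSpace.exp (s • -B)) i j)
      (fun s => (key s i j).differentiableAt) (fun s => (key s i j).deriv) t 0
    simpa using this
  have hB : NormedSpace.exp (t • -B) * NormedSpace.exp (t • B) = 1 := by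
    simpa using exp_neg_smul_mul_exp_smul B t
  calc NormedSpace.exp (t • A) * X
      = NormedSpace.exp (t • A) * X * (NormedSpace.exp (t • -B) * NormedSpace.exp (t • B)) := by
        rw [hB, Matrix.mul_one]
    _ = X * NormedSpace.exp (t • B) := by rw [← Matrix.mul_assoc, hc]

end MatrixCalculus

/-! ### Dissipation inequalities and the cost of one follower. -/

section AgentCost

variable {α β ι ν μ σ ρ π : Type*} [Fintype α] [Fintype ι] [Fintype ν] [Fintype μ] [Fintype σ]
  [Fintype ρ] [Fintype π]

theorem trace_mul_mul_transpose_nonneg {Q : Matrix ν ν ℝ} (hQ : Q.PosSemidef)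
    (N : Matrix α ν ℝ) : 0 ≤ (N * Q * Nᵀ).trace := by
  simpa using (hQ.mul_mul_conjTranspose_same N).trace_nonneg

theorem transpose_eq_of_posDef {ν : Type*} {Q : Matrix ν ν ℝ} (hQ : Q.PosDef) : Qᵀ = Q := by
  simpa using hQ.isHermitian.eq

/-- Dissipation of the filter storage function along the adjoint dynamics. -/
theorem filter_dissipation_identity {α : Type*} [DecidableEq σ] {A Q : Matrix ν ν ℝ}
    {C : Matrix σ ν ℝ} {D : Matrix σ ρ ℝ} {E : Matrix ν ρ ℝ} (hQ : Qᵀ = Q) (hDE : D * Eᵀ = 0) (hD : D * Dᵀ = 1)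
    {G : Matrix ν σ ℝ} (hG : G = -(Q * Cᵀ)) (N Y : Matrix α ν ℝ) :
    (N * (E + G * D) - Y * (G * D)) * (N * (E + G * D) - Y * (G * D))ᵀ
      + ((N * (A + G * C) - Y * (G * C)) * Q * Nᵀ
        + N * Q * (N * (A + G * C) - Y * (G * C))ᵀ)
      = N * (A * Q + Q * Aᵀ - Q * Cᵀ * C * Q + E * Eᵀ) * Nᵀ + Y * G * (Y * G)ᵀ := by
  -- The choice of `G` completes the square: every term containing `C` becomes quadratic in `G`, and
  -- all that remains outside the Riccati expression is `Y G (Y G)ᵀ`.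
  have hCQ : C * Q = -Gᵀ := by rw [hG]; simp [hQ]
  have hQC : Q * Cᵀ = -G := by rw [hG]; simp
  have hED : E * Dᵀ = 0 := by simpa using congrArg Matrix.transpose hDE
  have e1 : (N * (E + G * D) - Y * (G * D)) * (N * (E + G * D) - Y * (G * D))ᵀ
      = N * (E * Eᵀ) * Nᵀ + (N - Y) * G * (D * Dᵀ) * (Gᵀ * (N - Y)ᵀ)
        + N * (E * Dᵀ) * Gᵀ * (N - Y)ᵀ + (N - Y) * G * (D * Eᵀ) * Nᵀ := by
    simp only [Matrix.mul_add, Matrix.add_mul, Matrix.mul_sub, Matrix.sub_mul, Matrix.mul_assoc,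
      transpose_sub, transpose_mul, transpose_add]
    abel
  have e2 : (N * (A + G * C) - Y * (G * C)) * Q * Nᵀ
      = N * (A * Q) * Nᵀ + (N - Y) * G * (C * Q) * Nᵀ := by
    simp only [Matrix.mul_add, Matrix.add_mul, Matrix.sub_mul, Matrix.mul_assoc]
    abel
  have e3 : N * Q * (N * (A + G * C) - Y * (G * C))ᵀ
      = N * (Q * Aᵀ) * Nᵀ + N * (Q * Cᵀ) * Gᵀ * (N - Y)ᵀ := by
    simp only [Matrix.mul_add, Matrix.mul_sub, Matrix.mul_assoc, transpose_sub, transpose_mul,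
      transpose_add]
    abel
  have e4 : Q * Cᵀ * C * Q = G * Gᵀ := by
    rw [Matrix.mul_assoc _ C Q, hCQ, hQC]; simp
  rw [e1, e2, e3, e4, hCQ, hQC, hED, hDE, hD]
  simp only [Matrix.mul_add, Matrix.add_mul, Matrix.mul_sub, Matrix.sub_mul, Matrix.mul_neg,
    Matrix.neg_mul, Matrix.mul_zero, Matrix.zero_mul, Matrix.mul_one, Matrix.mul_assoc,
    transpose_sub, transpose_mul]
  abel

/-- Dissipation of the control storage function along the closed-loop dynamics. -/
theorem control_dissipation_identity [DecidableEq μ] {A P : Matrix ν ν ℝ} {B : Matrix ν μ ℝ} {C : Matrix π ν ℝ}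
    {D : Matrix π μ ℝ} (hP : Pᵀ = P) (hDC : Dᵀ * C = 0) (hD : Dᵀ * D = 1)
    {F : Matrix μ ν ℝ} (hF : F = -(Bᵀ * P)) :
    (C + D * F)ᵀ * (C + D * F) + ((A + B * F)ᵀ * P + P * (A + B * F))
      = Aᵀ * P + P * A - P * B * Bᵀ * P + Cᵀ * C := by
  have hCD : Cᵀ * D = 0 := by simpa using congrArg Matrix.transpose hDC
  have hBP : Bᵀ * P = -F := by rw [hF]; simp
  have hPB : P * B = -Fᵀ := by rw [hF]; simp [hP]
  have e1 : (C + D * F)ᵀ * (C + D * F)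
      = Cᵀ * C + Cᵀ * D * F + Fᵀ * (Dᵀ * C) + Fᵀ * (Dᵀ * D) * F := by
    simp only [Matrix.mul_add, Matrix.add_mul, Matrix.mul_assoc, transpose_mul, transpose_add]
    abel
  have e2 : (A + B * F)ᵀ * P + P * (A + B * F)
      = Aᵀ * P + P * A + Fᵀ * (Bᵀ * P) + P * B * F := by
    simp only [Matrix.mul_add, Matrix.add_mul, Matrix.mul_assoc, transpose_mul, transpose_add]
    abel
  rw [e1, e2, Matrix.mul_assoc (P * B), hCD, hDC, hD, hBP, hPB]
  simp only [Matrix.mul_neg, Matrix.neg_mul, Matrix.mul_zero, Matrix.zero_mul, Matrix.mul_one]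
  abel

theorem continuous_trace_mul_transpose {H : ℝ → Matrix α β ℝ} [Fintype β]
    (hH : ∀ i j, Continuous fun t => H t i j) :
    Continuous fun t => (H t * (H t)ᵀ).trace := by
  simp only [Matrix.trace, Matrix.diag_apply, Matrix.mul_apply, Matrix.transpose_apply]
  exact continuous_finsetSum _ fun i _ => continuous_finsetSum _ fun j _ => (hH i j).mul (hH i j)

/-- The `H₂` cost of the disturbances of one agent, whose error system is embedded in a larger one
by `X` (filter error) and `Y` (state estimate). -/
theorem integral_agent_cost_le [DecidableEq ι] [DecidableEq ν] [DecidableEq σ] [DecidableEq μ]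
    [DecidableEq π] {A P Q : Matrix ν ν ℝ} {B : Matrix ν μ ℝ} {E : Matrix ν ρ ℝ}
    {C1 : Matrix σ ν ℝ} {D1 : Matrix σ ρ ℝ} {C2 : Matrix π ν ℝ} {D2 : Matrix π μ ℝ}
    (hDE : D1 * Eᵀ = 0) (hDC : D2ᵀ * C2 = 0) (hD1 : D1 * D1ᵀ = 1) (hD2 : D2ᵀ * D2 = 1)
    (hP : P.PosDef) (hQ : Q.PosDef)
    (hcontrol : (-(Aᵀ * P + P * A - P * B * Bᵀ * P + C2ᵀ * C2)).PosSemidef)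
    (hfilter : (-(A * Q + Q * Aᵀ - Q * C1ᵀ * C1 * Q + E * Eᵀ)).PosSemidef)
    {F : Matrix μ ν ℝ} (hF : F = -(Bᵀ * P)) {G : Matrix ν σ ℝ} (hG : G = -(Q * C1ᵀ))
    {Ao : Matrix ι ι ℝ} {Co : Matrix α ι ℝ} {X Y : Matrix ι ν ℝ} {W : Matrix α π ℝ} {w : ℝ}
    (hX : Ao * X = X * (A + G * C1) - Y * (G * C1)) (hY : Ao * Y = Y * (A + B * F))
    (hCX : Co * X = W * C2) (hCY : Co * Y = W * (C2 + D2 * F)) (hw : 0 ≤ w) (hW : Wᵀ * W = w • 1)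
    {H : ℝ → Matrix α ρ ℝ}
    (hH : ∀ t, H t = Co * NormedSpace.exp (t • Ao) * (X * (E + G * D1) - Y * (G * D1)))
    {τ : ℝ} (hτ : 0 ≤ τ) :
    ∫ t in (0 : ℝ)..τ, (H t * (H t)ᵀ).trace
      ≤ w * ((C1 * Q * P * Q * C1ᵀ).trace + (C2 * Q * C2ᵀ).trace) := by
  have hQt : Qᵀ = Q := transpose_eq_of_posDef hQ
  have hPt : Pᵀ = P := transpose_eq_of_posDef hP
  set Φ : ℝ → Matrix α ι ℝ := fun t => Co * NormedSpace.exp (t • Ao) with hΦ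
  set N : ℝ → Matrix α ν ℝ := fun t => Φ t * X with hN
  set Z : ℝ → Matrix ν σ ℝ := fun t => NormedSpace.exp (t • (A + B * F)) * G with hZ
  -- The range of `Y` is invariant, so there the large exponential reduces to that of `A + B F`.
  have hΦY : ∀ t, Φ t * Y * G = W * (C2 + D2 * F) * Z t := by
    intro t
    simp only [hΦ, hZ]
    rw [Matrix.mul_assoc Co, exp_smul_mul_of_intertwine hY, ← Matrix.mul_assoc Co, hCY,
      Matrix.mul_assoc]
  have hNd : ∀ t, HasMatDerivAt N (N t * (A + G * C1) - Φ t * Y * (G * C1)) t := by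
    intro t
    have h := ((hasMatDerivAt_exp Ao t).const_mul Co).mul_const X
    have e : Co * (NormedSpace.exp (t • Ao) * Ao) * X
        = N t * (A + G * C1) - Φ t * Y * (G * C1) := by
      rw [← Matrix.mul_assoc, Matrix.mul_assoc _ Ao X, hX, Matrix.mul_sub]
      simp only [hN, hΦ, Matrix.mul_assoc]
    rwa [e] at h
  have hZd : ∀ t, HasMatDerivAt Z ((A + B * F) * Z t) t := by
    intro t
    have h := (hasMatDerivAt_exp' (A + B * F) t).mul_const G
    rwa [Matrix.mul_assoc] at h
  have hHt : ∀ t, H t = N t * (E + G * D1) - Φ t * Y * (G * D1) := by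
    intro t
    rw [hH, Matrix.mul_sub]
    simp only [hN, hΦ, Matrix.mul_assoc]
  have hHc : Continuous fun t => (H t * (H t)ᵀ).trace := by
    refine continuous_trace_mul_transpose fun i j => ?_
    simp only [hH]
    exact continuous_iff_continuousAt.2 fun t =>
      ((((hasMatDerivAt_exp Ao t).const_mul Co).mul_const _) i j).continuousAt
  -- The weight `w` makes the decrease of the second term match the energy `tr(W (C2 + D2 F) Z (W
  -- (C2 + D2 F) Z)ᵀ)` left over by the first.
  set V : ℝ → ℝ := fun t => (N t * Q * (N t)ᵀ).trace + w * ((Z t)ᵀ * P * Z t).trace with hV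
  have hVd : ∀ t, HasDerivAt V
      (((N t * (A + G * C1) - Φ t * Y * (G * C1)) * Q * (N t)ᵀ
          + N t * Q * (N t * (A + G * C1) - Φ t * Y * (G * C1))ᵀ).trace
        + w * ((((A + B * F) * Z t)ᵀ * P * Z t + (Z t)ᵀ * P * ((A + B * F) * Z t)).trace)) t := by
    intro t
    exact (((hNd t).mul_const Q).mul (hNd t).transpose).trace.add
      ((((hZd t).transpose.mul_const P).mul (hZd t)).trace.const_mul w)
  have hVnonneg : ∀ t, 0 ≤ V t := by
    intro t
    have h1 := trace_mul_mul_transpose_nonneg hQ.posSemidef (N t)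
    have h2 := trace_mul_mul_transpose_nonneg hP.posSemidef (Z t)ᵀ
    rw [transpose_transpose] at h2
    exact add_nonneg h1 (mul_nonneg hw h2)
  have hdiss : ∀ t, (H t * (H t)ᵀ).trace
      ≤ -(((N t * (A + G * C1) - Φ t * Y * (G * C1)) * Q * (N t)ᵀ
          + N t * Q * (N t * (A + G * C1) - Φ t * Y * (G * C1))ᵀ).trace
        + w * ((((A + B * F) * Z t)ᵀ * P * Z t + (Z t)ᵀ * P * ((A + B * F) * Z t)).trace)) := by
    intro t
    have h1 := congrArg Matrix.trace
      (filter_dissipation_identity (A := A) hQt hDE hD1 hG (N t) (Φ t * Y))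
    rw [← hHt, Matrix.trace_add, Matrix.trace_add, hΦY] at h1
    have h2 := trace_mul_mul_transpose_nonneg hfilter (N t)
    have h3 := trace_mul_mul_transpose_nonneg hcontrol (Z t)ᵀ
    rw [Matrix.mul_neg, Matrix.neg_mul, Matrix.trace_neg] at h2
    rw [← control_dissipation_identity (A := A) hPt hDC hD2 hF, Matrix.mul_neg, Matrix.neg_mul,
      Matrix.trace_neg, transpose_transpose, Matrix.mul_add, Matrix.add_mul, Matrix.trace_add] at h3
    have h4 : (W * (C2 + D2 * F) * Z t * (W * (C2 + D2 * F) * Z t)ᵀ).trace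
        = w * ((Z t)ᵀ * ((C2 + D2 * F)ᵀ * (C2 + D2 * F)) * Z t).trace := by
      have : (W * (C2 + D2 * F) * Z t)ᵀ * (W * (C2 + D2 * F) * Z t)
          = (Z t)ᵀ * (C2 + D2 * F)ᵀ * (Wᵀ * W) * ((C2 + D2 * F) * Z t) := by
        rw [Matrix.mul_assoc W, transpose_mul W, transpose_mul (C2 + D2 * F)]
        simp only [Matrix.mul_assoc]
      rw [Matrix.trace_mul_comm, this, hW, Matrix.mul_smul, Matrix.smul_mul, Matrix.trace_smul,
        Matrix.mul_one, smul_eq_mul]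
      simp only [Matrix.mul_assoc]
    have h5 : ((A + B * F) * Z t)ᵀ * P * Z t + (Z t)ᵀ * P * ((A + B * F) * Z t)
        = (Z t)ᵀ * ((A + B * F)ᵀ * P + P * (A + B * F)) * Z t := by
      rw [transpose_mul]
      simp only [Matrix.mul_assoc, Matrix.mul_add, Matrix.add_mul]
    rw [h5]
    rw [Matrix.trace_add, h4] at h1
    rw [Matrix.trace_add]
    nlinarith [mul_nonneg hw h3]
  -- Integrating the dissipation inequality gives the bound `V 0 - V τ`, and `V τ ≥ 0`.
  have hint := intervalIntegral.integral_le_sub_of_hasDeriv_right_of_le hτ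
    (g := fun t => -V t) (φ := fun t => (H t * (H t)ᵀ).trace)
    (fun t _ => (hVd t).continuousAt.neg.continuousWithinAt)
    (fun t _ => (hVd t).neg.hasDerivWithinAt) hHc.continuousOn.integrableOn_Icc
    (fun t _ => hdiss t)
  have hN0 : N 0 = W * C2 := by simp [hN, hΦ, hCX]
  have hZ0 : Z 0 = -(Q * C1ᵀ) := by simp [hZ, hG]
  have e1 : (W * C2 * Q * (W * C2)ᵀ).trace = w * (C2 * Q * C2ᵀ).trace := by
    have : (W * C2 * Q * (W * C2)ᵀ).trace = (Wᵀ * W * (C2 * Q * C2ᵀ)).trace := by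
      rw [transpose_mul, ← Matrix.mul_assoc, Matrix.trace_mul_comm]
      simp only [Matrix.mul_assoc]
    rw [this, hW, Matrix.smul_mul, Matrix.one_mul, Matrix.trace_smul, smul_eq_mul]
  have e2 : (-(Q * C1ᵀ))ᵀ * P * -(Q * C1ᵀ) = C1 * Q * P * Q * C1ᵀ := by
    simp [hQt, Matrix.mul_assoc]
  have hV0 : V 0 = w * ((C1 * Q * P * Q * C1ᵀ).trace + (C2 * Q * C2ᵀ).trace) := by
    simp only [hV, hN0, hZ0, e1, e2]
    ring
  have := hVnonneg τ
  linarith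

end AgentCost

/-! ### Spectral condition for decay of the matrix exponential. -/

section Hurwitz

variable {ι κ : Type*} [Fintype ι] [Fintype κ]

/-- All eigenvalues of a real matrix have negative real part, in terms of the real and imaginary
parts `a`, `b` of complex eigenvectors. -/
def NegRealParts (A : Matrix ι ι ℝ) : Prop :=
  ∀ (α β : ℝ) (a b : ι → ℝ), A *ᵥ a = α • a - β • b → A *ᵥ b = β • a + α • b →
    (a ≠ 0 ∨ b ≠ 0) → α < 0

theorem re_map_mulVec (A : Matrix ι ι ℝ) (x : ι → ℂ) (i : ι) :
    ((A.map (algebraMap ℝ ℂ) *ᵥ x) i).re = (A *ᵥ fun j => (x j).re) i := by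
  simp [Matrix.mulVec, dotProduct]

theorem im_map_mulVec (A : Matrix ι ι ℝ) (x : ι → ℂ) (i : ι) :
    ((A.map (algebraMap ℝ ℂ) *ᵥ x) i).im = (A *ᵥ fun j => (x j).im) i := by
  simp [Matrix.mulVec, dotProduct]

theorem NegRealParts.re_neg {A : Matrix ι ι ℝ} (hA : NegRealParts A) {μ : ℂ} {x : ι → ℂ}
    (hx : x ≠ 0) (h : A.map (algebraMap ℝ ℂ) *ᵥ x = μ • x) : μ.re < 0 := by
  refine hA μ.re μ.im (fun j => (x j).re) (fun j => (x j).im) ?_ ?_ ?_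
  · ext i
    rw [← re_map_mulVec, h]
    simp
  · ext i
    rw [← im_map_mulVec, h]
    simp
    ring
  · by_contra! hc
    refine hx (funext fun i => Complex.ext ?_ ?_)
    · exact congrFun hc.1 i
    · exact congrFun hc.2 i

theorem tendsto_exp_mul_pow_nhds_zero {μ : ℂ} (hμ : μ.re < 0) (k : ℕ) :
    Tendsto (fun t : ℝ => Complex.exp (t * μ) * (t : ℂ) ^ k) atTop (𝓝 0) := by
  rw [tendsto_zero_iff_norm_tendsto_zero]
  have h := (isLittleO_pow_exp_pos_mul_atTop k (neg_pos.2 hμ)).tendsto_div_nhds_zero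
  refine h.congr' ?_
  filter_upwards [eventually_ge_atTop 0] with t ht
  rw [norm_mul, Complex.norm_exp, norm_pow, Complex.norm_real, Real.norm_of_nonneg ht,
    div_eq_mul_inv, ← Real.exp_neg, mul_comm]
  congr 2
  simp
  ring

variable [DecidableEq ι]

attribute [local instance] Matrix.linftyOpNormedRing Matrix.linftyOpNormedAlgebra

/-- The exponential series applied to `x` stops after `k` terms, since all higher powers kill `x`.
-/
theorem exp_smul_mulVec_of_pow_mulVec_eq_zero {N : Matrix ι ι ℂ} {k : ℕ} {x : ι → ℂ}
    (h : N ^ k *ᵥ x = 0) (t : ℂ) :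
    NormedSpace.exp (t • N) *ᵥ x
      = ∑ j ∈ Finset.range k, ((j.factorial : ℂ)⁻¹ * t ^ j) • (N ^ j *ᵥ x) := by
  have hs := NormedSpace.exp_series_hasSum_exp' (𝕂 := ℂ) (t • N)
  let φ : Matrix ι ι ℂ →L[ℂ] (ι → ℂ) :=
    LinearMap.toContinuousLinearMap ((Matrix.mulVecBilin ℂ ℂ).flip x)
  have hφ := φ.hasSum hs
  have hz : ∀ j, k ≤ j → N ^ j *ᵥ x = 0 := by
    intro j hj
    rw [← Nat.sub_add_cancel hj, pow_add, ← Matrix.mulVec_mulVec, h, Matrix.mulVec_zero]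
  have e : ∀ j : ℕ, φ ((j.factorial : ℂ)⁻¹ • (t • N) ^ j)
      = ((j.factorial : ℂ)⁻¹ * t ^ j) • (N ^ j *ᵥ x) := by
    intro j
    rw [smul_pow, smul_smul, map_smul]
    rfl
  refine hφ.unique ?_
  simp only [e]
  exact hasSum_sum_of_ne_finset_zero fun j hj => by
    rw [hz j (by simpa using hj), smul_zero]

/-- Factoring `exp(tA) = exp(tμ) exp(t(A - μ))` leaves, on a generalized eigenvector, a polynomial
in `t` times a decaying scalar exponential. -/
theorem tendsto_exp_smul_mulVec_of_pow_mulVec_eq_zero {A : Matrix ι ι ℂ} {μ : ℂ} (hμ : μ.re < 0)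
    {k : ℕ} {x : ι → ℂ} (h : (A - μ • 1) ^ k *ᵥ x = 0) :
    Tendsto (fun t : ℝ => NormedSpace.exp ((t : ℂ) • A) *ᵥ x) atTop (𝓝 0) := by
  have e : ∀ t : ℝ, NormedSpace.exp ((t : ℂ) • A) *ᵥ x
      = ∑ j ∈ Finset.range k, (Complex.exp (t * μ) * (t : ℂ) ^ j) •
          ((j.factorial : ℂ)⁻¹ • ((A - μ • 1) ^ j *ᵥ x)) := by
    intro t
    have e1 : (t : ℂ) • A = ((t : ℂ) * μ) • (1 : Matrix ι ι ℂ) + (t : ℂ) • (A - μ • 1) := by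
      rw [smul_sub, smul_smul]; abel
    have e2 : NormedSpace.exp (((t : ℂ) * μ) • (1 : Matrix ι ι ℂ))
        = Complex.exp (t * μ) • (1 : Matrix ι ι ℂ) := by
      rw [← Algebra.algebraMap_eq_smul_one, ← Algebra.algebraMap_eq_smul_one,
        Complex.exp_eq_exp_ℂ]
      exact (NormedSpace.algebraMap_exp_comm _).symm
    rw [e1, Matrix.exp_add_of_commute _ _ ((Commute.one_left _).smul_left _), e2,
      Matrix.smul_mul, Matrix.one_mul, Matrix.smul_mulVec,
      exp_smul_mulVec_of_pow_mulVec_eq_zero h, Finset.smul_sum]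
    refine Finset.sum_congr rfl fun j _ => ?_
    rw [smul_smul, smul_smul]
    ring_nf
  simp only [e]
  rw [show (0 : ι → ℂ) = ∑ j ∈ Finset.range k,
    (0 : ℂ) • ((j.factorial : ℂ)⁻¹ • ((A - μ • 1) ^ j *ᵥ x)) by simp]
  exact tendsto_finsetSum _ fun j _ => (tendsto_exp_mul_pow_nhds_zero hμ j).smul_const _

/-- Over `ℂ` the generalized eigenspaces span, and decay is preserved by sums, so generalized
eigenvectors suffice. -/
theorem tendsto_exp_smul_mulVec_complex {A : Matrix ι ι ℂ}
    (hA : ∀ (μ : ℂ) (x : ι → ℂ), x ≠ 0 → A *ᵥ x = μ • x → μ.re < 0) (x : ι → ℂ) :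
    Tendsto (fun t : ℝ => NormedSpace.exp ((t : ℂ) • A) *ᵥ x) atTop (𝓝 0) := by
  have hx : x ∈ ⨆ μ : ℂ, Module.End.maxGenEigenspace (Matrix.toLin' A) μ := by
    rw [Module.End.iSup_maxGenEigenspace_eq_top]
    trivial
  induction hx using Submodule.iSup_induction' with
  | mem μ y hy =>
    obtain ⟨k, hk⟩ := (Module.End.mem_maxGenEigenspace _ _ _).1 hy
    rcases eq_or_ne y 0 with rfl | hy0
    · simp
    have hμ : Module.End.HasEigenvalue (Matrix.toLin' A) μ := by
      refine Module.End.hasEigenvalue_of_hasGenEigenvalue (k := k) fun hbot => hy0 ?_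
      rw [← Submodule.mem_bot ℂ, ← hbot]
      exact Module.End.mem_genEigenspace_nat.2 hk
    obtain ⟨v, hv⟩ := hμ.exists_hasEigenvector
    have hre : μ.re < 0 := hA μ v hv.2 (by simpa using hv.apply_eq_smul)
    refine tendsto_exp_smul_mulVec_of_pow_mulVec_eq_zero (k := k) hre ?_
    rw [← Matrix.toLin'_apply, Matrix.toLin'_pow, map_sub, map_smul, Matrix.toLin'_one]
    exact hk
  | zero => simp
  | add y z _ _ hy hz => simpa [Matrix.mulVec_add] using hy.add hz

/-- If all eigenvalues of `A` have negative real part, then `exp (t A) x → 0`. -/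
theorem NegRealParts.tendsto_exp_smul_mulVec {A : Matrix ι ι ℝ} (hA : NegRealParts A)
    (x : ι → ℝ) : Tendsto (fun t : ℝ => NormedSpace.exp (t • A) *ᵥ x) atTop (𝓝 0) := by
  have h := tendsto_exp_smul_mulVec_complex (A := A.map (algebraMap ℝ ℂ))
    (fun μ y hy h => hA.re_neg hy h) (fun i => (x i : ℂ))
  have e : ∀ t : ℝ, NormedSpace.exp ((t : ℂ) • A.map (algebraMap ℝ ℂ))
      = (NormedSpace.exp (t • A)).map (algebraMap ℝ ℂ) := by
    intro t
    have := NormedSpace.map_exp ((algebraMap ℝ ℂ).mapMatrix (m := ι))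
      (by
        refine continuous_matrix fun i j => ?_
        exact Complex.continuous_ofReal.comp (continuous_apply_apply i j)) (t • A)
    simp only [RingHom.mapMatrix_apply] at this
    have et : (t : ℂ) • A.map (algebraMap ℝ ℂ) = (t • A).map (algebraMap ℝ ℂ) := by
      ext i j
      simp
    rw [et]
    exact this.symm
  rw [tendsto_pi_nhds] at h ⊢
  intro i
  have hi := (Complex.continuous_re.tendsto _).comp (h i)
  simp only [Function.comp_def, e, re_map_mulVec] at hi
  simpa using hi

end Hurwitz

/-! ### Lyapunov criteria. -/

section Lyapunov

variable {ι : Type*} [Fintype ι]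

theorem dotProduct_lyapunov_mulVec {P : Matrix ι ι ℝ} (hP : Pᵀ = P) (A : Matrix ι ι ℝ)
    (x : ι → ℝ) : x ⬝ᵥ (Aᵀ * P + P * A) *ᵥ x = 2 * (x ⬝ᵥ P *ᵥ (A *ᵥ x)) := by
  have : x ⬝ᵥ (Aᵀ * P) *ᵥ x = x ⬝ᵥ P *ᵥ (A *ᵥ x) := by
    rw [← Matrix.mulVec_mulVec, Matrix.dotProduct_mulVec, Matrix.vecMul_transpose,
      Matrix.dotProduct_mulVec, ← Matrix.mulVec_transpose, hP, dotProduct_comm,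
      Matrix.dotProduct_mulVec x, ← Matrix.mulVec_transpose, hP, dotProduct_comm]
  rw [Matrix.add_mulVec, dotProduct_add, this, ← Matrix.mulVec_mulVec]
  ring

/-- Lyapunov's criterion. -/
theorem negRealParts_of_lyapunov {A P : Matrix ι ι ℝ} (hP : P.PosDef)
    (h : (-(Aᵀ * P + P * A)).PosDef) : NegRealParts A := by
  intro α β a b ha hb hne
  have hPt : Pᵀ = P := transpose_eq_of_posDef hP
  -- By symmetry the `β` cross terms cancel on adding the forms at `a` and `b`, leaving `2α(aᵀPa +
  -- bᵀPb) < 0`.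
  have hsym : a ⬝ᵥ P *ᵥ b = b ⬝ᵥ P *ᵥ a := by
    rw [Matrix.dotProduct_mulVec, ← Matrix.mulVec_transpose, hPt, dotProduct_comm]
  have e1 := dotProduct_lyapunov_mulVec hPt A a
  have e2 := dotProduct_lyapunov_mulVec hPt A b
  rw [ha] at e1
  rw [hb] at e2
  simp only [Matrix.mulVec_sub, Matrix.mulVec_add, Matrix.mulVec_smul, dotProduct_sub,
    dotProduct_add, dotProduct_smul, smul_eq_mul] at e1 e2
  have nn : ∀ {R : Matrix ι ι ℝ}, R.PosDef → ∀ x : ι → ℝ, 0 ≤ x ⬝ᵥ R *ᵥ x := by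
    intro R hR x
    simpa using hR.posSemidef.dotProduct_mulVec_nonneg x
  have pos : ∀ {R : Matrix ι ι ℝ}, R.PosDef → 0 < a ⬝ᵥ R *ᵥ a + b ⬝ᵥ R *ᵥ b := by
    intro R hR
    rcases hne with h0 | h0
    · have := hR.dotProduct_mulVec_pos h0
      exact add_pos_of_pos_of_nonneg (by simpa using this) (nn hR b)
    · have := hR.dotProduct_mulVec_pos h0
      exact add_pos_of_nonneg_of_pos (nn hR a) (by simpa using this)
  have h1 := pos hP
  have h2 := pos h
  simp only [Matrix.neg_mulVec, dotProduct_neg] at h2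
  rw [e1, e2, hsym] at h2
  by_contra! hα
  nlinarith [mul_nonneg hα h1.le]

/-- Congruence by `Q⁻¹` turns the dual inequality into the Lyapunov inequality with `P = Q⁻¹`. -/
theorem negRealParts_of_dual_lyapunov [DecidableEq ι] {A Q : Matrix ι ι ℝ} (hQ : Q.PosDef)
    (h : (-(A * Q + Q * Aᵀ)).PosDef) : NegRealParts A := by
  have hu : IsUnit Q.det := hQ.det_pos.ne'.isUnit
  have hQt : Qᵀ = Q := transpose_eq_of_posDef hQ
  refine negRealParts_of_lyapunov hQ.inv ?_
  have e : -(Aᵀ * Q⁻¹ + Q⁻¹ * A) = (Q⁻¹)ᴴ * -(A * Q + Q * Aᵀ) * Q⁻¹ := by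
    have : (Q⁻¹)ᴴ = Q⁻¹ := hQ.inv.isHermitian.eq
    rw [this, Matrix.mul_neg, Matrix.neg_mul, Matrix.mul_add, Matrix.add_mul,
      ← Matrix.mul_assoc Q⁻¹ Q, Matrix.nonsing_inv_mul _ hu, Matrix.one_mul,
      Matrix.mul_assoc Q⁻¹ (A * Q), Matrix.mul_assoc A, Matrix.mul_nonsing_inv _ hu,
      Matrix.mul_one, add_comm]
  rw [e]
  refine h.conjTranspose_mul_mul_same ?_
  exact Matrix.mulVec_injective_of_isUnit (Matrix.isUnit_nonsing_inv_iff.2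
    ((Matrix.isUnit_iff_isUnit_det _).2 hu))

end Lyapunov

/-! ### Linear differential equations on the half line. -/

section LinearODE

variable {ι : Type*} [Fintype ι] [DecidableEq ι]

/-- Solutions of `X' = A X` on `[0, ∞)` are given by the matrix exponential. -/
theorem eq_exp_smul_mulVec_of_hasDerivWithinAt {A : Matrix ι ι ℝ} {X : ℝ → ι → ℝ}
    (hX : ∀ t, 0 ≤ t → HasDerivWithinAt X (A *ᵥ X t) (Set.Ici 0) t) {t : ℝ} (ht : 0 ≤ t) :
    X t = NormedSpace.exp (t • A) *ᵥ X 0 := by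
  -- Pulling the solution back by the flow makes it constant.
  set W : ℝ → ι → ℝ := fun s => NormedSpace.exp (-s • A) *ᵥ X s with hW
  have hE : ∀ s, HasMatDerivAt (fun s : ℝ => NormedSpace.exp (-s • A))
      (NormedSpace.exp (-s • A) * -A) s := by
    intro s
    simpa using hasMatDerivAt_exp (-A) s
  have hWd : ∀ s, 0 ≤ s → HasDerivWithinAt W 0 (Set.Ici 0) s := by
    intro s hs
    rw [hasDerivWithinAt_pi]
    intro i
    have hi : HasDerivWithinAt (fun s => W s i)
        (∑ j, ((NormedSpace.exp (-s • A) * -A) i j * X s j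
          + NormedSpace.exp (-s • A) i j * (A *ᵥ X s) j)) (Set.Ici 0) s := by
      simp only [hW, Matrix.mulVec, dotProduct]
      exact HasDerivWithinAt.fun_sum fun j _ =>
        ((hE s i j).hasDerivWithinAt).mul (hasDerivWithinAt_pi.1 (hX s hs) j)
    have e : ∑ j, ((NormedSpace.exp (-s • A) * -A) i j * X s j
        + NormedSpace.exp (-s • A) i j * (A *ᵥ X s) j) = 0 := by
      rw [Finset.sum_add_distrib]
      change ((NormedSpace.exp (-s • A) * -A) *ᵥ X s) i
        + (NormedSpace.exp (-s • A) *ᵥ (A *ᵥ X s)) i = 0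
      simp [Matrix.mulVec_mulVec, Matrix.neg_mulVec]
    rwa [e] at hi
  have hc : W t = W 0 := by
    refine constant_of_has_deriv_right_zero (a := 0) (b := t) ?_ ?_ t ⟨ht, le_rfl⟩
    · exact fun s hs => (hWd s hs.1).continuousWithinAt.mono Set.Icc_subset_Ici_self
    · exact fun s hs => (hWd s hs.1).mono (Set.Ici_subset_Ici.2 hs.1)
  have h0 : W 0 = X 0 := by simp [hW]
  rw [← h0, ← hc, hW, Matrix.mulVec_mulVec, exp_smul_mul_exp_neg_smul, Matrix.one_mulVec]

/-- Solutions on `[0, ∞)` of an asymptotically stable linear system tend to zero. -/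
theorem NegRealParts.tendsto_of_hasDerivWithinAt {A : Matrix ι ι ℝ} (hA : NegRealParts A)
    {X : ℝ → ι → ℝ} (hX : ∀ t, 0 ≤ t → HasDerivWithinAt X (A *ᵥ X t) (Set.Ici 0) t) :
    Tendsto X atTop (𝓝 0) := by
  refine (hA.tendsto_exp_smul_mulVec (X 0)).congr' ?_
  filter_upwards [eventually_ge_atTop 0] with t ht
  exact (eq_exp_smul_mulVec_of_hasDerivWithinAt hX ht).symm

end LinearODE

/-! ### Diagonalization of real symmetric matrices. -/

section Symmetric

variable {ι : Type*} [Fintype ι] [DecidableEq ι]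

theorem eigenvectorUnitary_mul_transpose {L : Matrix ι ι ℝ} (hL : L.IsHermitian) :
    (hL.eigenvectorUnitary : Matrix ι ι ℝ) * (hL.eigenvectorUnitary : Matrix ι ι ℝ)ᵀ = 1 := by
  have := Unitary.coe_mul_star_self hL.eigenvectorUnitary
  simpa [Matrix.star_eq_conjTranspose] using this

theorem mul_eigenvectorUnitary_eq {L : Matrix ι ι ℝ} (hL : L.IsHermitian) :
    L * (hL.eigenvectorUnitary : Matrix ι ι ℝ)
      = (hL.eigenvectorUnitary : Matrix ι ι ℝ) * diagonal hL.eigenvalues := by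
  ext i k
  have := congrFun (hL.mulVec_eigenvectorBasis k) i
  rw [Matrix.mul_diagonal]
  simpa [Matrix.mul_apply, Matrix.mulVec, dotProduct, mul_comm] using this

/-- The columns of a positive semidefinite matrix have norm at most its largest eigenvalue. -/
theorem sum_sq_col_le {L : Matrix ι ι ℝ} (hL : L.PosSemidef) {l : ℝ}
    (hl : ∀ μ ∈ spectrum ℝ L, μ ≤ l) (j : ι) : ∑ i, L i j ^ 2 ≤ l ^ 2 := by
  have hH := hL.isHermitian
  set U : Matrix ι ι ℝ := hH.eigenvectorUnitary.1 with hU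
  have hUU : U * Uᵀ = 1 := eigenvectorUnitary_mul_transpose hH
  have hLU : L * U = U * diagonal hH.eigenvalues := mul_eigenvectorUnitary_eq hH
  have hLt : Lᵀ = L := by simpa using hH.eq
  -- Its `j`-th diagonal entry averages the squared eigenvalues with weights `U j k ^ 2`, which sum
  -- to one by orthogonality.
  have e : Lᵀ * L = U * diagonal (fun k => hH.eigenvalues k ^ 2) * Uᵀ := by
    calc Lᵀ * L = L * (L * U) * Uᵀ := by
          rw [hLt, ← Matrix.mul_assoc, Matrix.mul_assoc (L * L), hUU, Matrix.mul_one]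
      _ = _ := by
          rw [hLU, ← Matrix.mul_assoc, hLU, Matrix.mul_assoc U, diagonal_mul_diagonal]
          simp only [pow_two]
  have e1 := congrFun (congrFun e j) j
  have e2 := congrFun (congrFun hUU j) j
  rw [Matrix.mul_apply, Matrix.mul_apply] at e1
  rw [Matrix.mul_apply, Matrix.one_apply_eq] at e2
  simp only [Matrix.transpose_apply, Matrix.mul_diagonal, ← pow_two] at e1 e2
  rw [e1, ← mul_one (l ^ 2), ← e2, Finset.mul_sum]
  refine Finset.sum_le_sum fun k _ => ?_
  have h1 : hH.eigenvalues k ≤ l := hl _ (hH.eigenvalues_mem_spectrum_real k)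
  have h0 : 0 ≤ hH.eigenvalues k := hL.eigenvalues_nonneg k
  have h2 : hH.eigenvalues k ^ 2 ≤ l ^ 2 := by gcongr
  nlinarith [mul_le_mul_of_nonneg_right h2 (sq_nonneg (U j k))]

theorem eq_zero_of_forall_sum_eigenvectorUnitary {L : Matrix ι ι ℝ} (hL : L.IsHermitian)
    {x : ι → ℝ} (h : ∀ k, ∑ i, (hL.eigenvectorUnitary : Matrix ι ι ℝ) i k * x i = 0) : x = 0 := by
  have h0 : (hL.eigenvectorUnitary : Matrix ι ι ℝ)ᵀ *ᵥ x = 0 := funext h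
  rw [← Matrix.one_mulVec x, ← eigenvectorUnitary_mul_transpose hL,
    ← Matrix.mulVec_mulVec, h0, Matrix.mulVec_zero]

end Symmetric

/-! ### Stability of the reference block `I ⊗ S - L₁ ⊗ I`. -/

section Reference

theorem re_eq_zero_of_eigenvector {r : ℕ} {S : Matrix (Fin r) (Fin r) ℝ}
    (hS : EigenvaluesImaginary S) {α β : ℝ} {a b : Fin r → ℝ}
    (ha : S *ᵥ a = α • a - β • b) (hb : S *ᵥ b = β • a + α • b) (hne : a ≠ 0 ∨ b ≠ 0) : α = 0 := by
  set x : Fin r → ℂ := fun i => ⟨a i, b i⟩ with hx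
  set μ : ℂ := ⟨α, β⟩ with hμ
  have hx0 : x ≠ 0 := by
    intro h
    have h1 : a = 0 := funext fun i => by simpa [hx] using congrArg Complex.re (congrFun h i)
    have h2 : b = 0 := funext fun i => by simpa [hx] using congrArg Complex.im (congrFun h i)
    exact hne.elim (fun h => h h1) (fun h => h h2)
  have he : S.map (algebraMap ℝ ℂ) *ᵥ x = μ • x := by
    ext i
    refine Complex.ext ?_ ?_
    · rw [re_map_mulVec]
      simpa [hx, hμ] using congrFun ha i
    · rw [im_map_mulVec]
      have := congrFun hb i
      simp only [Pi.add_apply, Pi.smul_apply, smul_eq_mul] at this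
      simp [hx, hμ, this, add_comm]
  have hv : Module.End.HasEigenvector (Matrix.toLin' (S.map (algebraMap ℝ ℂ))) μ x :=
    Module.End.hasEigenvector_iff.2 ⟨Module.End.mem_eigenspace_iff.2 (by simpa using he), hx0⟩
  have hm := (Module.End.hasEigenvalue_of_hasEigenvector hv).mem_spectrum
  rw [Matrix.spectrum_toLin'] at hm
  exact hS μ hm

/-- The system matrix `I ⊗ S - L ⊗ I` has eigenvalues with negative real parts. -/
theorem reference_re_neg {ι : Type*} [Fintype ι] [DecidableEq ι] {r : ℕ}
    {S : Matrix (Fin r) (Fin r) ℝ} (hS : EigenvaluesImaginary S) {L : Matrix ι ι ℝ}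
    (hL : L.PosDef) {α β : ℝ} {a b : ι → Fin r → ℝ}
    (ha : ∀ i, S *ᵥ a i - ∑ j, L i j • a j = α • a i - β • b i)
    (hb : ∀ i, S *ᵥ b i - ∑ j, L i j • b j = β • a i + α • b i) (hne : a ≠ 0 ∨ b ≠ 0) :
    α < 0 := by
  have hH := hL.isHermitian
  set U : Matrix ι ι ℝ := hH.eigenvectorUnitary.1 with hU
  have hLt : ∀ i j, L i j = L j i := fun i j => by simpa using (hH.apply i j).symm
  have hLU : ∀ j k, ∑ i, U i k * L i j = hH.eigenvalues k * U j k := by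
    intro j k
    have := congrFun (congrFun (mul_eigenvectorUnitary_eq hH) j) k
    rw [Matrix.mul_diagonal, Matrix.mul_apply] at this
    rw [mul_comm _ (U j k), ← this]
    exact Finset.sum_congr rfl fun i _ => by rw [hLt i j, mul_comm]
  have proj : ∀ (c : ι → Fin r → ℝ) (k : ι), ∑ i, U i k • ∑ j, L i j • c j
      = hH.eigenvalues k • ∑ j, U j k • c j := by
    intro c k
    simp only [Finset.smul_sum, smul_smul]
    rw [Finset.sum_comm]
    simp only [← Finset.sum_smul, hLU]
  -- A nonzero projection onto an eigenvector of `L` is an eigenvector of `S` with real part `λ_k +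
  -- α`. That must vanish, so `α = -λ_k < 0`.
  obtain ⟨k, hk⟩ : ∃ k, (∑ i, U i k • a i) ≠ 0 ∨ (∑ i, U i k • b i) ≠ 0 := by
    by_contra! hall
    have hz : ∀ c : ι → Fin r → ℝ, (∀ k, ∑ i, U i k • c i = 0) → c = 0 := by
      intro c hc
      ext i l
      exact congrFun (eq_zero_of_forall_sum_eigenvectorUnitary hH (x := fun i => c i l)
        fun k => by
          have := congrFun (hc k) l
          simp only [Finset.sum_apply, Pi.smul_apply, smul_eq_mul, Pi.zero_apply] at this
          exact this) i
    exact hne.elim (fun h => h (hz a fun k => (hall k).1)) (fun h => h (hz b fun k => (hall k).2))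
  have hSa : S *ᵥ (∑ i, U i k • a i) = (hH.eigenvalues k + α) • (∑ i, U i k • a i)
      - β • ∑ i, U i k • b i := by
    have : ∀ i, S *ᵥ a i = (∑ j, L i j • a j) + (α • a i - β • b i) := fun i => by
      rw [← ha i]; abel
    rw [Matrix.mulVec_sum, add_smul, ← proj, Finset.smul_sum, Finset.smul_sum,
      ← Finset.sum_add_distrib, ← Finset.sum_sub_distrib]
    refine Finset.sum_congr rfl fun i _ => ?_
    rw [Matrix.mulVec_smul, this, smul_add, smul_sub, smul_comm α, smul_comm β]
    abel
  have hSb : S *ᵥ (∑ i, U i k • b i) = β • (∑ i, U i k • a i)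
      + (hH.eigenvalues k + α) • ∑ i, U i k • b i := by
    have : ∀ i, S *ᵥ b i = (∑ j, L i j • b j) + (β • a i + α • b i) := fun i => by
      rw [← hb i]; abel
    rw [Matrix.mulVec_sum, add_smul, ← proj, Finset.smul_sum, Finset.smul_sum,
      ← Finset.sum_add_distrib, ← Finset.sum_add_distrib]
    refine Finset.sum_congr rfl fun i _ => ?_
    rw [Matrix.mulVec_smul, this, smul_add, smul_add, smul_comm α, smul_comm β]
    abel
  have h0 := re_eq_zero_of_eigenvector hS hSa hSb hk
  have := hL.eigenvalues_pos k
  linarith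

end Reference

/-! ### The follower block of the Laplacian. -/

section Graph

variable {M K : ℕ} {G : Digraph (Agent M K)}

theorem adjacency_nonneg {V : Type} (G : Digraph V) (i j : V) : 0 ≤ adjacency G i j := by
  unfold adjacency
  split_ifs <;> norm_num

theorem adjacency_eq_one {V : Type} {G : Digraph V} {i j : V} (hij : i ≠ j) (h : G.Adj j i) :
    adjacency G i j = 1 := by
  simp [adjacency, hij, h]

theorem GraphAssumption.adjacency_symm (hG : GraphAssumption G) (i j : Fin M) :
    adjacency G (Sum.inl i) (Sum.inl j) = adjacency G (Sum.inl j) (Sum.inl i) := by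
  unfold adjacency
  congr 1
  exact propext ⟨fun h => ⟨h.1.symm, hG.followers_undirected _ _ h.2⟩,
    fun h => ⟨h.1.symm, hG.followers_undirected _ _ h.2⟩⟩

theorem L₁_apply (G : Digraph (Agent M K)) (i j : Fin M) :
    L₁ G i j = (if i = j then (∑ k : Fin M, adjacency G (Sum.inl i) (Sum.inl k))
      + ∑ k : Fin K, adjacency G (Sum.inl i) (Sum.inr k) else 0)
      - adjacency G (Sum.inl i) (Sum.inl j) := by
  simp [L₁, laplacian, Matrix.toBlocks₁₁, Matrix.diagonal_apply]

theorem L₂_apply (G : Digraph (Agent M K)) (i : Fin M) (k : Fin K) :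
    L₂ G i k = -adjacency G (Sum.inl i) (Sum.inr k) := by
  simp [L₂, laplacian, Matrix.toBlocks₁₂]

theorem L₁_mulVec (G : Digraph (Agent M K)) (x : Fin M → ℝ) (i : Fin M) :
    (L₁ G *ᵥ x) i = (∑ j : Fin M, adjacency G (Sum.inl i) (Sum.inl j) * (x i - x j))
      + (∑ k : Fin K, adjacency G (Sum.inl i) (Sum.inr k)) * x i := by
  simp only [Matrix.mulVec, dotProduct, L₁_apply, sub_mul, ite_mul, zero_mul,
    Finset.sum_sub_distrib, Finset.sum_ite_eq, Finset.mem_univ, if_true, mul_sub, add_mul,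
    ← Finset.sum_mul]
  ring

/-- Since follower weights are symmetric, exchanging the summation indices symmetrizes the mixed
terms into half a sum of squares; links from leaders act only on the diagonal. -/
theorem GraphAssumption.dotProduct_L₁_mulVec (hG : GraphAssumption G) (x : Fin M → ℝ) :
    x ⬝ᵥ L₁ G *ᵥ x
      = (∑ i : Fin M, ∑ j : Fin M, adjacency G (Sum.inl i) (Sum.inl j) * (x i - x j) ^ 2) / 2
        + ∑ i : Fin M, (∑ k : Fin K, adjacency G (Sum.inl i) (Sum.inr k)) * x i ^ 2 := by
  have e : ∑ i : Fin M, ∑ j : Fin M, adjacency G (Sum.inl i) (Sum.inl j) * (x i - x j) * x i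
      = -∑ i : Fin M, ∑ j : Fin M, adjacency G (Sum.inl i) (Sum.inl j) * (x i - x j) * x j := by
    conv_rhs => rw [Finset.sum_comm]
    simp only [← Finset.sum_neg_distrib]
    refine Finset.sum_congr rfl fun i _ => Finset.sum_congr rfl fun j _ => ?_
    rw [hG.adjacency_symm j i]
    ring
  have e2 : ∑ i : Fin M, ∑ j : Fin M, adjacency G (Sum.inl i) (Sum.inl j) * (x i - x j) ^ 2
      = ∑ i : Fin M, ∑ j : Fin M, adjacency G (Sum.inl i) (Sum.inl j) * (x i - x j) * x i
        - ∑ i : Fin M, ∑ j : Fin M, adjacency G (Sum.inl i) (Sum.inl j) * (x i - x j) * x j := by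
    simp only [← Finset.sum_sub_distrib]
    refine Finset.sum_congr rfl fun i _ => Finset.sum_congr rfl fun j _ => ?_
    ring
  simp only [dotProduct, L₁_mulVec, mul_add, Finset.sum_add_distrib]
  congr 1
  · rw [e2]
    have : ∑ i : Fin M, x i * ∑ j : Fin M, adjacency G (Sum.inl i) (Sum.inl j) * (x i - x j)
        = ∑ i : Fin M, ∑ j : Fin M,
            adjacency G (Sum.inl i) (Sum.inl j) * (x i - x j) * x i := by
      simp only [Finset.mul_sum]
      exact Finset.sum_congr rfl fun i _ => Finset.sum_congr rfl fun j _ => by ring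
    linarith
  · exact Finset.sum_congr rfl fun i _ => by ring

/-- The grounded Laplacian of the followers is positive definite. -/
theorem GraphAssumption.posDef_L₁ (hK : 0 < K) (hG : GraphAssumption G) : (L₁ G).PosDef := by
  refine Matrix.PosDef.of_dotProduct_mulVec_pos ?_ fun x hx => ?_
  · ext i j
    rw [Matrix.conjTranspose_apply, star_trivial, L₁_apply, L₁_apply, hG.adjacency_symm j i]
    rcases eq_or_ne i j with rfl | h
    · rfl
    · rw [if_neg h, if_neg h.symm]
  have hx' : 0 < x ⬝ᵥ L₁ G *ᵥ x := by
    rw [hG.dotProduct_L₁_mulVec]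
    have n1 : ∀ i j : Fin M, 0 ≤ adjacency G (Sum.inl i) (Sum.inl j) * (x i - x j) ^ 2 :=
      fun i j => mul_nonneg (adjacency_nonneg _ _ _) (sq_nonneg _)
    have n2 : ∀ i : Fin M, 0 ≤ (∑ k : Fin K, adjacency G (Sum.inl i) (Sum.inr k)) * x i ^ 2 :=
      fun i => mul_nonneg (Finset.sum_nonneg fun k _ => adjacency_nonneg _ _ _) (sq_nonneg _)
    have m1 := Finset.sum_nonneg fun i (_ : i ∈ Finset.univ) =>
      Finset.sum_nonneg fun j (_ : j ∈ Finset.univ) => n1 i j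
    have m2 := Finset.sum_nonneg fun i (_ : i ∈ Finset.univ) => n2 i
    by_contra! hle
    have z1 := (Finset.sum_eq_zero_iff_of_nonneg fun i _ =>
      Finset.sum_nonneg fun j _ => n1 i j).1 (by linarith :
        ∑ i : Fin M, ∑ j : Fin M, adjacency G (Sum.inl i) (Sum.inl j) * (x i - x j) ^ 2 = 0)
    have z2 := (Finset.sum_eq_zero_iff_of_nonneg fun i _ => n2 i).1 (by linarith :
        ∑ i : Fin M, (∑ k : Fin K, adjacency G (Sum.inl i) (Sum.inr k)) * x i ^ 2 = 0)
    -- A vanishing form forces equal values across follower edges, hence a constant by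
    -- connectedness; a follower that hears a leader then makes the constant zero.
    have hadj : ∀ i j : Fin M, i ≠ j → G.Adj (Sum.inl j) (Sum.inl i) → x i = x j := by
      intro i j hij h
      have := (Finset.sum_eq_zero_iff_of_nonneg fun j _ => n1 i j).1
        (z1 i (Finset.mem_univ _)) j (Finset.mem_univ _)
      rw [adjacency_eq_one (by simpa using hij) h, one_mul] at this
      exact sub_eq_zero.1 (pow_eq_zero_iff two_ne_zero |>.1 this)
    have hconst : ∀ i j : Fin M, x i = x j := by
      intro i j
      obtain ⟨w⟩ := hG.followers_connected.preconnected i j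
      induction w with
      | nil => rfl
      | cons h _ ih =>
        rw [← ih]
        rw [SimpleGraph.fromRel_adj] at h
        rcases h.2 with h2 | h2
        · exact (hadj _ _ h.1.symm h2).symm
        · exact hadj _ _ h.1 h2
    obtain ⟨i, hi⟩ := hG.leaders_share ⟨0, hK⟩
    have hi0 : x i = 0 := by
      have := z2 i (Finset.mem_univ _)
      have hpos : 0 < ∑ k : Fin K, adjacency G (Sum.inl i) (Sum.inr k) :=
        Finset.sum_pos' (fun k _ => adjacency_nonneg _ _ _)
          ⟨⟨0, hK⟩, Finset.mem_univ _, by rw [adjacency_eq_one (by simp) hi]; exact one_pos⟩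
      exact pow_eq_zero_iff two_ne_zero |>.1 ((mul_eq_zero.1 this).resolve_left hpos.ne')
    exact hx (funext fun j => (hconst j i).trans hi0)
  simpa using hx'

end Graph

/-! ### Block structure of the error matrix and its stability. -/

section Stack

theorem blockDiagonal'_mulVec_apply {o : Type*} [Fintype o] [DecidableEq o] {a b : o → Type*}
    [∀ i, Fintype (b i)] (D : ∀ i, Matrix (a i) (b i) ℝ) (v : (Σ i, b i) → ℝ) (i : o) (k : a i) :
    (blockDiagonal' D *ᵥ v) ⟨i, k⟩ = (D i *ᵥ fun l => v ⟨i, l⟩) k := by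
  simp only [Matrix.mulVec, dotProduct]
  rw [Fintype.sum_sigma, Finset.sum_eq_single i]
  · simp [blockDiagonal'_apply_eq]
  · intro j _ hj
    exact Finset.sum_eq_zero fun l _ => by
      rw [blockDiagonal'_apply_ne D _ _ hj.symm, zero_mul]
  · simp

theorem kron_mulVec_apply {M a b : ℕ} (X : Matrix (Fin M) (Fin M) ℝ)
    (Y : Matrix (Fin a) (Fin b) ℝ) (v : Stack (fun _ : Fin M => b) → ℝ) (i : Fin M) (k : Fin a) :
    (kron X Y *ᵥ v) ⟨i, k⟩ = ∑ j, X i j * (Y *ᵥ fun l => v ⟨j, l⟩) k := by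
  simp only [Matrix.mulVec, dotProduct]
  rw [Fintype.sum_sigma]
  refine Finset.sum_congr rfl fun j _ => ?_
  rw [Finset.mul_sum]
  refine Finset.sum_congr rfl fun l _ => ?_
  simp [kron, mul_assoc]

variable {M K r p : ℕ} {n m q s : Fin M → ℕ}
  (𝒩 : MultiAgent M K r p n m q s) (pr : Protocol M r n m s)

theorem errA_mulVec_filter (x : ErrState r n → ℝ) (i : Fin M) (k : Fin (n i)) :
    (errA 𝒩 pr *ᵥ x) (Sum.inl ⟨i, k⟩)
      = (((𝒩.fol i).A + pr.G i * (𝒩.fol i).C1) *ᵥ fun l => x (Sum.inl ⟨i, l⟩)) k := by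
  rw [errA, ← blockDiagonal'_mul, ← blockDiagonal'_add, fromBlocks_mulVec]
  simp [-blockDiagonal'_mul, blockDiagonal'_mulVec_apply, Function.comp_def, Matrix.add_mulVec]

theorem errA_mulVec_control (x : ErrState r n → ℝ) (i : Fin M) (k : Fin (n i)) :
    (errA 𝒩 pr *ᵥ x) (Sum.inr (Sum.inl ⟨i, k⟩))
      = -(((𝒩.fol i).B * pr.F i) *ᵥ fun l => x (Sum.inl ⟨i, l⟩)) k
        + (((𝒩.fol i).A + (𝒩.fol i).B * pr.F i) *ᵥ fun l => x (Sum.inr (Sum.inl ⟨i, l⟩))) k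
        + (pr.Pi i *ᵥ fun l => x (Sum.inr (Sum.inr ⟨i, l⟩))) k := by
  rw [errA, ← blockDiagonal'_mul, ← blockDiagonal'_mul, ← blockDiagonal'_add,
    ← blockDiagonal'_add, ← blockDiagonal'_neg, fromBlocks_mulVec]
  simp [-blockDiagonal'_mul, fromRows_mulVec, fromBlocks_mulVec, blockDiagonal'_mulVec_apply,
    Function.comp_def, Matrix.add_mulVec, Matrix.neg_mulVec, add_assoc]

theorem errA_mulVec_reference (x : ErrState r n → ℝ) (i : Fin M) (k : Fin r) :
    (errA 𝒩 pr *ᵥ x) (Sum.inr (Sum.inr ⟨i, k⟩))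
      = (𝒩.S *ᵥ fun l => x (Sum.inr (Sum.inr ⟨i, l⟩))) k
        - ∑ j, L₁ 𝒩.graph i j * x (Sum.inr (Sum.inr ⟨j, k⟩)) := by
  rw [errA, fromBlocks_mulVec]
  simp [fromRows_mulVec, fromBlocks_mulVec, kron_mulVec_apply, Function.comp_def,
    Matrix.sub_mulVec, Matrix.one_apply]

variable {𝒩 pr}

/-- The error system is asymptotically stable if all its diagonal blocks are. -/
theorem negRealParts_errA (hAe : ∀ i, NegRealParts ((𝒩.fol i).A + pr.G i * (𝒩.fol i).C1))
    (hAc : ∀ i, NegRealParts ((𝒩.fol i).A + (𝒩.fol i).B * pr.F i))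
    (hS : EigenvaluesImaginary 𝒩.S) (hL : (L₁ 𝒩.graph).PosDef) : NegRealParts (errA 𝒩 pr) := by
  intro α β a b ha hb hne
  -- The reference and filter rows are autonomous, while the control row is driven by both. It can
  -- be used as an eigenvector equation once the other two components vanish.
  by_cases h3 : (fun (i : Fin M) (l : Fin r) => a (Sum.inr (Sum.inr ⟨i, l⟩))) ≠ 0
      ∨ (fun (i : Fin M) (l : Fin r) => b (Sum.inr (Sum.inr ⟨i, l⟩))) ≠ 0
  · refine reference_re_neg (β := β) hS hL (fun i => ?_) (fun i => ?_) h3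
    · ext k
      have := congrFun ha (Sum.inr (Sum.inr ⟨i, k⟩))
      rw [errA_mulVec_reference] at this
      simpa using this
    · ext k
      have := congrFun hb (Sum.inr (Sum.inr ⟨i, k⟩))
      rw [errA_mulVec_reference] at this
      simpa using this
  by_cases h1 : ∃ i, (fun l : Fin (n i) => a (Sum.inl ⟨i, l⟩)) ≠ 0
      ∨ (fun l : Fin (n i) => b (Sum.inl ⟨i, l⟩)) ≠ 0
  · obtain ⟨i, hi⟩ := h1
    refine hAe i α β _ _ ?_ ?_ hi
    · ext k
      have := congrFun ha (Sum.inl ⟨i, k⟩)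
      rwa [errA_mulVec_filter] at this
    · ext k
      have := congrFun hb (Sum.inl ⟨i, k⟩)
      rwa [errA_mulVec_filter] at this
  push Not at h1 h3
  by_cases h2 : ∃ i, (fun l : Fin (n i) => a (Sum.inr (Sum.inl ⟨i, l⟩))) ≠ 0
      ∨ (fun l : Fin (n i) => b (Sum.inr (Sum.inl ⟨i, l⟩))) ≠ 0
  · obtain ⟨i, hi⟩ := h2
    refine hAc i α β _ _ ?_ ?_ hi
    · ext k
      have := congrFun ha (Sum.inr (Sum.inl ⟨i, k⟩))
      rw [errA_mulVec_control, (h1 i).1, congrFun h3.1 i] at this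
      simpa using this
    · ext k
      have := congrFun hb (Sum.inr (Sum.inl ⟨i, k⟩))
      rw [errA_mulVec_control, (h1 i).2, congrFun h3.2 i] at this
      simpa using this
  push Not at h2
  exfalso
  have ha0 : a = 0 := by
    ext (⟨i, k⟩ | ⟨i, k⟩ | ⟨i, k⟩)
    · exact congrFun (h1 i).1 k
    · exact congrFun (h2 i).1 k
    · exact congrFun (congrFun h3.1 i) k
  have hb0 : b = 0 := by
    ext (⟨i, k⟩ | ⟨i, k⟩ | ⟨i, k⟩)
    · exact congrFun (h1 i).2 k
    · exact congrFun (h2 i).2 k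
    · exact congrFun (congrFun h3.2 i) k
  exact hne.elim (fun h => h ha0) (fun h => h hb0)

end Stack

/-! ### Error dynamics along closed-loop trajectories. -/

section Trajectory

theorem hasDerivWithinAt_const_mulVec {α β : Type*} [Fintype α] [Fintype β] (C : Matrix α β ℝ)
    {f : ℝ → β → ℝ} {f' : β → ℝ} {T : Set ℝ} {t : ℝ} (h : HasDerivWithinAt f f' T t) :
    HasDerivWithinAt (fun u => C *ᵥ f u) (C *ᵥ f') T t :=
  (LinearMap.toContinuousLinearMap C.mulVecLin).hasFDerivAt.comp_hasDerivWithinAt t h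

theorem tendsto_const_mulVec {α β γ : Type*} [Fintype β] (C : Matrix α β ℝ)
    {f : γ → β → ℝ} {l : Filter γ} (h : Tendsto f l (𝓝 0)) :
    Tendsto (fun u => C *ᵥ f u) l (𝓝 0) := by
  have hc : Continuous fun x : β → ℝ => C *ᵥ x := continuous_const.matrix_mulVec continuous_id
  simpa [Function.comp_def] using (hc.tendsto 0).comp h

variable {M K r p : ℕ} {n m q s : Fin M → ℕ}
  {𝒩 : MultiAgent M K r p n m q s} {pr : Protocol M r n m s} {σ : Signals M K r n}

/-- The neighbourhood disagreement `(L₁ ⊗ I) v + (L₂ ⊗ I) x_l` of the reference systems. -/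
noncomputable def disagreement (G : Digraph (Agent M K)) (σ : Signals M K r n) (i : Fin M) (t : ℝ) :
    Fin r → ℝ :=
  ∑ j, L₁ G i j • σ.v j t + ∑ k, L₂ G i k • σ.xl k t

/-- State of the error system along a closed-loop trajectory. -/
noncomputable def errorState (𝒩 : MultiAgent M K r p n m q s) (pr : Protocol M r n m s) (σ : Signals M K r n)
    (t : ℝ) : ErrState r n → ℝ :=
  Sum.elim (fun a => (σ.xf a.1 t - σ.w a.1 t) a.2)
    (Sum.elim (fun a => (σ.xf a.1 t - pr.Pi a.1 *ᵥ σ.v a.1 t) a.2)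
      (fun a => disagreement 𝒩.graph σ a.1 t a.2))

theorem coupling_eq_neg_disagreement (G : Digraph (Agent M K)) (σ : Signals M K r n) (i : Fin M)
    (t : ℝ) :
    ∑ j : Fin M, adjacency G (Sum.inl i) (Sum.inl j) • (σ.v j t - σ.v i t)
        + ∑ k : Fin K, adjacency G (Sum.inl i) (Sum.inr k) • (σ.xl k t - σ.v i t)
      = -disagreement G σ i t := by
  simp only [disagreement, L₁_apply, L₂_apply, sub_smul, ite_smul, zero_smul,
    Finset.sum_sub_distrib, Finset.sum_ite_eq, Finset.mem_univ, if_true, smul_sub, add_smul,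
    ← Finset.sum_smul, neg_smul, Finset.sum_neg_distrib]
  abel

theorem hullPoint_mulVec {a b : ℕ} (G : Digraph (Agent M K)) (R : Matrix (Fin b) (Fin a) ℝ)
    (x : Fin K → Fin a → ℝ) (i : Fin M) :
    hullPoint G (fun k => R *ᵥ x k) i = R *ᵥ hullPoint G x i := by
  simp only [hullPoint, Matrix.mulVec_sum, Matrix.mulVec_smul]

/-- Inverting `L₁` turns decay of the disagreement into convergence of `v` to the hull point. -/
theorem sum_inv_smul_disagreement {G : Digraph (Agent M K)} (hL : IsUnit (L₁ G).det) (i : Fin M)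
    (t : ℝ) :
    ∑ j, (L₁ G)⁻¹ i j • disagreement G σ j t
      = σ.v i t - hullPoint G (fun k => σ.xl k t) i := by
  have e1 : ∑ j, (L₁ G)⁻¹ i j • ∑ k, L₁ G j k • σ.v k t = σ.v i t := by
    simp only [Finset.smul_sum, smul_smul]
    rw [Finset.sum_comm]
    simp only [← Finset.sum_smul, ← Matrix.mul_apply, Matrix.nonsing_inv_mul _ hL]
    simp [Matrix.one_apply]
  have e2 : ∑ j, (L₁ G)⁻¹ i j • ∑ k, L₂ G j k • σ.xl k t
      = -hullPoint G (fun k => σ.xl k t) i := by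
    simp only [Finset.smul_sum, smul_smul, hullPoint, Matrix.neg_apply, neg_smul,
      Finset.sum_neg_distrib, neg_neg]
    rw [Finset.sum_comm]
    simp only [← Finset.sum_smul, ← Matrix.mul_apply]
  simp only [disagreement, smul_add, Finset.sum_add_distrib, e1, e2]
  abel

theorem IsTrajectory.hasDerivWithinAt_v {d : ∀ i : Fin M, ℝ → (Fin (q i) → ℝ)}
    (h : IsTrajectory 𝒩 pr d σ) (i : Fin M) {t : ℝ} (ht : 0 ≤ t) :
    HasDerivWithinAt (σ.v i) (𝒩.S *ᵥ σ.v i t - disagreement 𝒩.graph σ i t) (Set.Ici 0) t := by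
  have := h.reference i t ht
  rwa [add_assoc, coupling_eq_neg_disagreement, ← sub_eq_add_neg] at this

/-- The leaders and the reference systems share the drift `S`, so it commutes with the Laplacian
weights and the disagreement evolves autonomously. -/
theorem IsTrajectory.hasDerivWithinAt_disagreement {d : ∀ i : Fin M, ℝ → (Fin (q i) → ℝ)}
    (h : IsTrajectory 𝒩 pr d σ) (i : Fin M) {t : ℝ} (ht : 0 ≤ t) :
    HasDerivWithinAt (disagreement 𝒩.graph σ i)
      (𝒩.S *ᵥ disagreement 𝒩.graph σ i t
        - ∑ j, L₁ 𝒩.graph i j • disagreement 𝒩.graph σ j t) (Set.Ici 0) t := by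
  have hd : HasDerivWithinAt (disagreement 𝒩.graph σ i)
      (∑ j, L₁ 𝒩.graph i j • (𝒩.S *ᵥ σ.v j t - disagreement 𝒩.graph σ j t)
        + ∑ k, L₂ 𝒩.graph i k • (𝒩.S *ᵥ σ.xl k t)) (Set.Ici 0) t :=
    (HasDerivWithinAt.fun_sum fun j _ => (h.hasDerivWithinAt_v j ht).fun_const_smul _).fun_add
      (HasDerivWithinAt.fun_sum fun k _ => (h.leader k t ht).fun_const_smul _)
  convert hd using 1
  simp only [smul_sub, Finset.sum_sub_distrib]
  conv_lhs => rw [disagreement]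
  simp only [Matrix.mulVec_add, Matrix.mulVec_sum, Matrix.mulVec_smul]
  abel

/-- The first regulator equation cancels the drift that `Γ v` and `Π S v` produce in `x - Π v`. -/
theorem IsTrajectory.hasDerivWithinAt_errorState (hreg : RegulatorEquations 𝒩 pr.Pi pr.Gam)
    (h : IsTrajectory 𝒩 pr (fun _ _ => 0) σ) {t : ℝ} (ht : 0 ≤ t) :
    HasDerivWithinAt (errorState 𝒩 pr σ) (errA 𝒩 pr *ᵥ errorState 𝒩 pr σ t) (Set.Ici 0) t := by
  rw [hasDerivWithinAt_pi]
  rintro (⟨i, k⟩ | ⟨i, k⟩ | ⟨i, k⟩)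
  · rw [errA_mulVec_filter]
    have := hasDerivWithinAt_pi.1 ((h.follower i t ht).sub (h.observer i t ht)) k
    refine HasDerivWithinAt.congr_deriv this (Eq.symm ?_)
    change (_ *ᵥ (σ.xf i t - σ.w i t)) k = _
    refine congrFun ?_ k
    simp only [Signals.y, Matrix.mulVec_zero, add_zero, Matrix.add_mulVec, Matrix.mulVec_sub,
      Matrix.mulVec_mulVec]
    abel
  · rw [errA_mulVec_control]
    have := hasDerivWithinAt_pi.1 ((h.follower i t ht).sub
      (hasDerivWithinAt_const_mulVec (pr.Pi i) (h.hasDerivWithinAt_v i ht))) k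
    refine HasDerivWithinAt.congr_deriv this (Eq.symm ?_)
    change -(_ *ᵥ (σ.xf i t - σ.w i t)) k + (_ *ᵥ (σ.xf i t - pr.Pi i *ᵥ σ.v i t)) k
      + (_ *ᵥ disagreement 𝒩.graph σ i t) k = _
    rw [← Pi.neg_apply, ← Pi.add_apply, ← Pi.add_apply]
    refine congrFun ?_ k
    have hr := congrArg (fun T => T *ᵥ σ.v i t) (hreg i).1
    simp only [Matrix.add_mulVec] at hr
    simp only [Signals.u, Matrix.mulVec_zero, add_zero, Matrix.add_mulVec, Matrix.mulVec_sub,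
      Matrix.mulVec_add, Matrix.mulVec_mulVec, ← hr, Matrix.mul_assoc, Matrix.add_mul]
    abel
  · rw [errA_mulVec_reference]
    have := hasDerivWithinAt_pi.1 (h.hasDerivWithinAt_disagreement i ht) k
    refine HasDerivWithinAt.congr_deriv this (Eq.symm ?_)
    simp [errorState]

/-- The second regulator equation makes the output error linear in the error coordinates, leaving no
persistent term. -/
theorem zf_sub_hullPoint (hreg : RegulatorEquations 𝒩 pr.Pi pr.Gam) (i : Fin M) (t : ℝ) :
    σ.zf 𝒩 pr i t - hullPoint 𝒩.graph (fun k => σ.zl 𝒩 k t) i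
      = ((𝒩.fol i).C2 + (𝒩.fol i).D2 * pr.F i) *ᵥ (σ.xf i t - pr.Pi i *ᵥ σ.v i t)
        - ((𝒩.fol i).D2 * pr.F i) *ᵥ (σ.xf i t - σ.w i t)
        + 𝒩.R *ᵥ (σ.v i t - hullPoint 𝒩.graph (fun k => σ.xl k t) i) := by
  have hr := congrArg (fun T => T *ᵥ σ.v i t) (hreg i).2
  simp only [Matrix.add_mulVec] at hr
  simp only [Signals.zf, Signals.zl, hullPoint_mulVec, Signals.u, Matrix.mulVec_sub,
    Matrix.mulVec_add, Matrix.add_mulVec, Matrix.mulVec_mulVec, ← hr, Matrix.mul_assoc,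
    Matrix.add_mul]
  abel

theorem achievesOutputContainment (hreg : RegulatorEquations 𝒩 pr.Pi pr.Gam)
    (hA : NegRealParts (errA 𝒩 pr)) (hL : IsUnit (L₁ 𝒩.graph).det) :
    AchievesOutputContainment 𝒩 pr := by
  intro σ h i
  have hX := hA.tendsto_of_hasDerivWithinAt fun t ht => h.hasDerivWithinAt_errorState hreg ht
  rw [tendsto_pi_nhds] at hX
  have he : Tendsto (fun t => σ.xf i t - σ.w i t) atTop (𝓝 0) :=
    tendsto_pi_nhds.2 fun k => hX (Sum.inl ⟨i, k⟩)
  have hδ : Tendsto (fun t => σ.xf i t - pr.Pi i *ᵥ σ.v i t) atTop (𝓝 0) :=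
    tendsto_pi_nhds.2 fun k => hX (Sum.inr (Sum.inl ⟨i, k⟩))
  have hζ : ∀ j, Tendsto (disagreement 𝒩.graph σ j) atTop (𝓝 0) := fun j =>
    tendsto_pi_nhds.2 fun k => hX (Sum.inr (Sum.inr ⟨j, k⟩))
  have hξ : Tendsto (fun t => σ.v i t - hullPoint 𝒩.graph (fun k => σ.xl k t) i)
      atTop (𝓝 0) := by
    simp only [← sum_inv_smul_disagreement hL]
    simpa using tendsto_finsetSum Finset.univ fun j _ => (hζ j).const_smul ((L₁ 𝒩.graph)⁻¹ i j)
  refine ⟨?_, ?_, hξ⟩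
  · simp only [zf_sub_hullPoint hreg]
    simpa using ((tendsto_const_mulVec ((𝒩.fol i).C2 + (𝒩.fol i).D2 * pr.F i) hδ).sub
      (tendsto_const_mulVec ((𝒩.fol i).D2 * pr.F i) he)).add (tendsto_const_mulVec 𝒩.R hξ)
  · simpa using he.neg

end Trajectory

/-! ### Invariant subspaces excited by one follower's disturbance. -/

section Embedding

variable {M : ℕ}

/-- Embedding of the `j`-th block into stacked vectors. -/
def stackInj (a : Fin M → ℕ) (j : Fin M) : Matrix (Stack a) (Fin (a j)) ℝ :=
  (1 : Matrix (Stack a) (Stack a) ℝ).submatrix id fun k => ⟨j, k⟩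

theorem mul_stackInj {α : Type*} {a : Fin M → ℕ} (T : Matrix α (Stack a) ℝ) (j : Fin M) :
    T * stackInj a j = T.submatrix id fun k => ⟨j, k⟩ := by
  ext x k
  simp [stackInj, Matrix.mul_apply, Matrix.one_apply]

theorem blockDiagonal'_mul_stackInj {a b : Fin M → ℕ}
    (D : ∀ i, Matrix (Fin (a i)) (Fin (b i)) ℝ) (j : Fin M) :
    blockDiagonal' D * stackInj b j = stackInj a j * D j := by
  rw [mul_stackInj]
  ext ⟨i, k⟩ l
  rw [Matrix.submatrix_apply, id, Matrix.mul_apply]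
  by_cases h : i = j
  · subst h
    rw [blockDiagonal'_apply_eq, Finset.sum_eq_single k]
    · rw [stackInj, Matrix.submatrix_apply, id, Matrix.one_apply_eq, one_mul]
    · intro c _ hc
      simp [stackInj, hc.symm]
    · simp
  · rw [blockDiagonal'_apply_ne D _ _ h]
    exact (Finset.sum_eq_zero fun c _ => by simp [stackInj, h]).symm

theorem blockDiagonal'_mul_stackInj_mul {α : Type*} {a b : Fin M → ℕ}
    (D : ∀ i, Matrix (Fin (a i)) (Fin (b i)) ℝ) (j : Fin M) (T : Matrix (Fin (b j)) α ℝ) :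
    blockDiagonal' D * (stackInj b j * T) = stackInj a j * (D j * T) := by
  rw [← Matrix.mul_assoc, blockDiagonal'_mul_stackInj, Matrix.mul_assoc]

/-- Block column `j` of `L₁ ⊗ I` consists of scalar multiples of the identity, so it scales norms by
one factor; this decouples the cost of follower `j` from the network. -/
theorem transpose_mul_kron_stackInj (L : Matrix (Fin M) (Fin M) ℝ) (p : ℕ) (j : Fin M) :
    (kron L (1 : Matrix (Fin p) (Fin p) ℝ) * stackInj (fun _ => p) j)ᵀ
        * (kron L (1 : Matrix (Fin p) (Fin p) ℝ) * stackInj (fun _ => p) j)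
      = (∑ i, L i j ^ 2) • (1 : Matrix (Fin p) (Fin p) ℝ) := by
  rw [mul_stackInj]
  ext a b
  rw [Matrix.mul_apply, Fintype.sum_sigma, Matrix.smul_apply, smul_eq_mul, Finset.sum_mul]
  refine Finset.sum_congr rfl fun i _ => ?_
  simp [kron, Matrix.one_apply, pow_two, eq_comm]

theorem trace_transpose_mul_self_eq_sum {α : Type*} [Fintype α] {a : Fin M → ℕ}
    (T : Matrix α (Stack a) ℝ) :
    (Tᵀ * T).trace = ∑ j, ((T * stackInj a j) * (T * stackInj a j)ᵀ).trace := by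
  simp only [mul_stackInj]
  simp only [Matrix.trace_mul_comm _ (_ᵀ)]
  simp only [Matrix.trace, Matrix.diag_apply, Matrix.mul_apply, Matrix.transpose_apply,
    Matrix.submatrix_apply, id]
  rw [Fintype.sum_sigma]

variable {K r p : ℕ} {n m q s : Fin M → ℕ}
  (𝒩 : MultiAgent M K r p n m q s) (pr : Protocol M r n m s) (j : Fin M)

/-- Filter error coordinates of follower `j` in the error system. -/
def filterInj (r : ℕ) (n : Fin M → ℕ) (j : Fin M) : Matrix (ErrState r n) (Fin (n j)) ℝ :=
  fromRows (stackInj n j) (fromRows (stackInj n j) 0)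

/-- State estimate coordinates of follower `j` in the error system. -/
def estimateInj (r : ℕ) (n : Fin M → ℕ) (j : Fin M) : Matrix (ErrState r n) (Fin (n j)) ℝ :=
  fromRows 0 (fromRows (stackInj n j) 0)

/-- The filter error enters both `x - w` and `x - Π v`, so the estimate coordinate `w - Π v` is
their difference and is driven by `-G C₁ e`. -/
theorem errA_mul_filterInj : errA 𝒩 pr * filterInj r n j
    = filterInj r n j * ((𝒩.fol j).A + pr.G j * (𝒩.fol j).C1)
      - estimateInj r n j * (pr.G j * (𝒩.fol j).C1) := by
  simp only [errA, filterInj, estimateInj, fromBlocks_mul_fromRows, fromCols_mul_fromRows,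
    fromRows_mul, Matrix.add_mul, Matrix.mul_add, Matrix.neg_mul, Matrix.mul_assoc,
    blockDiagonal'_mul_stackInj, blockDiagonal'_mul_stackInj_mul]
  ext (x | x | x) k <;> simp

theorem errA_mul_estimateInj : errA 𝒩 pr * estimateInj r n j
    = estimateInj r n j * ((𝒩.fol j).A + (𝒩.fol j).B * pr.F j) := by
  simp only [errA, estimateInj, fromBlocks_mul_fromRows, fromCols_mul_fromRows,
    fromRows_mul, Matrix.add_mul, Matrix.mul_add, Matrix.neg_mul, Matrix.mul_assoc,
    blockDiagonal'_mul_stackInj, blockDiagonal'_mul_stackInj_mul]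
  ext (x | x | x) k <;> simp

theorem errE_mul_stackInj : errE 𝒩 pr * stackInj q j
    = filterInj r n j * ((𝒩.fol j).E + pr.G j * (𝒩.fol j).D1)
      - estimateInj r n j * (pr.G j * (𝒩.fol j).D1) := by
  simp only [errE, filterInj, estimateInj, fromRows_mul, Matrix.add_mul, Matrix.mul_add,
    Matrix.mul_assoc, blockDiagonal'_mul_stackInj, blockDiagonal'_mul_stackInj_mul]
  ext (x | x | x) k <;> simp

theorem errC_mul_filterInj : errC 𝒩 pr * filterInj r n j
    = kron (L₁ 𝒩.graph) (1 : Matrix (Fin p) (Fin p) ℝ) * stackInj (fun _ => p) j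
      * (𝒩.fol j).C2 := by
  simp only [errC, filterInj, fromCols_mul_fromRows, Matrix.add_mul, Matrix.mul_add,
    Matrix.neg_mul, Matrix.mul_zero, Matrix.mul_assoc, blockDiagonal'_mul_stackInj,
    blockDiagonal'_mul_stackInj_mul]
  abel

theorem errC_mul_estimateInj : errC 𝒩 pr * estimateInj r n j
    = kron (L₁ 𝒩.graph) (1 : Matrix (Fin p) (Fin p) ℝ) * stackInj (fun _ => p) j
      * ((𝒩.fol j).C2 + (𝒩.fol j).D2 * pr.F j) := by
  simp only [errC, estimateInj, fromCols_mul_fromRows, Matrix.add_mul, Matrix.mul_add,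
    Matrix.mul_zero, Matrix.mul_assoc, blockDiagonal'_mul_stackInj,
    blockDiagonal'_mul_stackInj_mul]
  abel

end Embedding

/-! ### Splitting the cost by follower and passing to the infinite horizon. -/

section Cost

variable {M K r p : ℕ} {n m q s : Fin M → ℕ} {𝒩 : MultiAgent M K r p n m q s}

theorem impulseResponse_mul_stackInj (pr : Protocol M r n m s) (j : Fin M) (t : ℝ) :
    impulseResponse 𝒩 pr t * stackInj q j
      = errC 𝒩 pr * NormedSpace.exp (t • errA 𝒩 pr)
        * (filterInj r n j * ((𝒩.fol j).E + pr.G j * (𝒩.fol j).D1)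
          - estimateInj r n j * (pr.G j * (𝒩.fol j).D1)) := by
  rw [impulseResponse, Matrix.mul_assoc _ (errE 𝒩 pr), errE_mul_stackInj]

theorem continuous_impulseResponse_apply (pr : Protocol M r n m s) (a : Stack fun _ : Fin M => p)
    (b : Stack q) : Continuous fun t => impulseResponse 𝒩 pr t a b :=
  continuous_iff_continuousAt.2 fun t =>
    ((((hasMatDerivAt_exp (errA 𝒩 pr) t).const_mul (errC 𝒩 pr)).mul_const (errE 𝒩 pr))
      a b).continuousAt

theorem continuous_trace_agent (pr : Protocol M r n m s) (j : Fin M) :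
    Continuous fun t => ((impulseResponse 𝒩 pr t * stackInj q j)
      * (impulseResponse 𝒩 pr t * stackInj q j)ᵀ).trace :=
  continuous_trace_mul_transpose fun a b => by
    simp only [mul_stackInj]
    exact continuous_impulseResponse_apply pr _ _

theorem costDensity_eq_sum (pr : Protocol M r n m s) (t : ℝ) :
    costDensity 𝒩 pr t = ∑ j, ((impulseResponse 𝒩 pr t * stackInj q j)
      * (impulseResponse 𝒩 pr t * stackInj q j)ᵀ).trace :=
  trace_transpose_mul_self_eq_sum _

theorem costDensity_nonneg (pr : Protocol M r n m s) (t : ℝ) : 0 ≤ costDensity 𝒩 pr t := by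
  simpa [costDensity] using
    (Matrix.posSemidef_conjTranspose_mul_self (impulseResponse 𝒩 pr t)).trace_nonneg

theorem continuous_costDensity (pr : Protocol M r n m s) : Continuous (costDensity 𝒩 pr) := by
  rw [funext (costDensity_eq_sum pr)]
  exact continuous_finsetSum _ fun j _ => continuous_trace_agent pr j

/-- A uniform bound on the finite horizon costs bounds the infinite horizon cost. -/
theorem integrableOn_costDensity_and_cost_le (pr : Protocol M r n m s) {I : ℝ}
    (h : ∀ τ, 0 ≤ τ → ∫ t in (0 : ℝ)..τ, costDensity 𝒩 pr t ≤ I) :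
    IntegrableOn (costDensity 𝒩 pr) (Set.Ioi 0) ∧ cost 𝒩 pr ≤ I := by
  have hint : IntegrableOn (costDensity 𝒩 pr) (Set.Ioi 0) := by
    refine integrableOn_Ioi_of_intervalIntegral_norm_bounded (ι := ℝ) (l := atTop) (b := id) I 0
      (fun τ => ((continuous_costDensity pr).integrableOn_Icc).mono_set Set.Ioc_subset_Icc_self)
      tendsto_id ?_
    filter_upwards [eventually_ge_atTop 0] with τ hτ
    simpa only [Real.norm_of_nonneg (costDensity_nonneg pr _), id_eq] using h τ hτ
  refine ⟨hint, le_of_tendsto (intervalIntegral_tendsto_integral_Ioi 0 hint tendsto_id) ?_⟩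
  filter_upwards [eventually_ge_atTop 0] with τ hτ using h τ hτ

end Cost
end Containment

/-! ### The main theorem. -/

open Containment in
theorem theorem4 {M K r p : ℕ} {n m q s : Fin M → ℕ} (hM : 0 < M) (hK : 0 < K)
    (𝒩 : Containment.MultiAgent M K r p n m q s) (hstand : Containment.StandingAssumption 𝒩)
    (Pi : ∀ i : Fin M, Matrix (Fin (n i)) (Fin r) ℝ)
    (Gam : ∀ i : Fin M, Matrix (Fin (m i)) (Fin r) ℝ)
    (hreg : Containment.RegulatorEquations 𝒩 Pi Gam)
    (hDE : ∀ i, (𝒩.fol i).D1 * (𝒩.fol i).Eᵀ = 0)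
    (hDC : ∀ i, (𝒩.fol i).D2ᵀ * (𝒩.fol i).C2 = 0)
    (hD1 : ∀ i, (𝒩.fol i).D1 * (𝒩.fol i).D1ᵀ = 1)
    (hD2 : ∀ i, (𝒩.fol i).D2ᵀ * (𝒩.fol i).D2 = 1)
    (lamM : ℝ) (hlam : IsGreatest (spectrum ℝ (Containment.L₁ 𝒩.graph)) lamM)
    (γ : ℝ) (hγ : 0 < γ)
    (P Q : ∀ i : Fin M, Matrix (Fin (n i)) (Fin (n i)) ℝ)
    (hP : ∀ i, (P i).PosDef) (hQ : ∀ i, (Q i).PosDef)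
    (hcontrol : ∀ i, Containment.NegDef
      ((𝒩.fol i).Aᵀ * P i + P i * (𝒩.fol i).A
        - P i * (𝒩.fol i).B * (𝒩.fol i).Bᵀ * P i + (𝒩.fol i).C2ᵀ * (𝒩.fol i).C2))
    (hfilter : ∀ i, Containment.NegDef
      ((𝒩.fol i).A * Q i + Q i * (𝒩.fol i).Aᵀ
        - Q i * (𝒩.fol i).C1ᵀ * (𝒩.fol i).C1 * Q i + (𝒩.fol i).E * (𝒩.fol i).Eᵀ))
    (htrace : ∀ i,
      ((𝒩.fol i).C1 * Q i * P i * Q i * (𝒩.fol i).C1ᵀ).trace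
        + ((𝒩.fol i).C2 * Q i * (𝒩.fol i).C2ᵀ).trace < γ / (M * lamM ^ 2)) :
    Containment.AchievesOutputContainment 𝒩 (Containment.riccatiProtocol 𝒩 Pi Gam P Q) ∧
      MeasureTheory.IntegrableOn (Containment.costDensity 𝒩 (Containment.riccatiProtocol 𝒩 Pi Gam P Q)) (Set.Ioi 0) ∧
      Containment.cost 𝒩 (Containment.riccatiProtocol 𝒩 Pi Gam P Q) < γ := by
  set pr := riccatiProtocol 𝒩 Pi Gam P Q with hpr
  have hL : (L₁ 𝒩.graph).PosDef := hstand.graph.posDef_L₁ hK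
  have hF : ∀ i, pr.F i = -((𝒩.fol i).Bᵀ * P i) := fun _ => rfl
  have hG : ∀ i, pr.G i = -(Q i * (𝒩.fol i).C1ᵀ) := fun _ => rfl
  have hQt : ∀ i, (Q i)ᵀ = Q i := fun i => transpose_eq_of_posDef (hQ i)
  have hAc : ∀ i, NegRealParts ((𝒩.fol i).A + (𝒩.fol i).B * pr.F i) := fun i => by
    refine negRealParts_of_lyapunov (hP i) ?_
    have e := control_dissipation_identity (A := (𝒩.fol i).A) (B := (𝒩.fol i).B)
      (transpose_eq_of_posDef (hP i)) (hDC i) (hD2 i) (hF i)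
    have h := (hcontrol i).add_posSemidef
      (Matrix.posSemidef_conjTranspose_mul_self ((𝒩.fol i).C2 + (𝒩.fol i).D2 * pr.F i))
    rw [← e, Matrix.conjTranspose_eq_transpose_of_trivial] at h
    convert h using 1
    abel
  have hAe : ∀ i, NegRealParts ((𝒩.fol i).A + pr.G i * (𝒩.fol i).C1) := fun i => by
    refine negRealParts_of_dual_lyapunov (hQ i) ?_
    -- With `N = 1` and `Y = 0` the identity becomes the closed-loop form of the filter Riccati
    -- expression.
    have e := filter_dissipation_identity (A := (𝒩.fol i).A) (hQt i) (hDE i) (hD1 i) (hG i)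
      (1 : Matrix (Fin (n i)) (Fin (n i)) ℝ) 0
    simp only [Matrix.one_mul, Matrix.zero_mul, sub_zero, Matrix.transpose_one, Matrix.mul_one,
      add_zero, Matrix.transpose_zero] at e
    have h := (hfilter i).add_posSemidef
      (Matrix.posSemidef_self_mul_conjTranspose ((𝒩.fol i).E + pr.G i * (𝒩.fol i).D1))
    rw [← e, Matrix.conjTranspose_eq_transpose_of_trivial] at h
    convert h using 1
    abel
  refine ⟨achievesOutputContainment hreg (negRealParts_errA hAe hAc hstand.imaginary hL)
    hL.det_pos.ne'.isUnit, ?_⟩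
  set c : Fin M → ℝ := fun j => ((𝒩.fol j).C1 * Q j * P j * Q j * (𝒩.fol j).C1ᵀ).trace
    + ((𝒩.fol j).C2 * Q j * (𝒩.fol j).C2ᵀ).trace with hc
  have hc0 : ∀ j, 0 ≤ c j := fun j => by
    refine add_nonneg ?_ (trace_mul_mul_transpose_nonneg (hQ j).posSemidef _)
    have := trace_mul_mul_transpose_nonneg (hP j).posSemidef ((𝒩.fol j).C1 * Q j)
    rwa [Matrix.transpose_mul, hQt, ← Matrix.mul_assoc] at this
  have hagent : ∀ j τ, 0 ≤ τ → ∫ t in (0 : ℝ)..τ, ((impulseResponse 𝒩 pr t * stackInj q j)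
      * (impulseResponse 𝒩 pr t * stackInj q j)ᵀ).trace ≤ (∑ i, L₁ 𝒩.graph i j ^ 2) * c j :=
    fun j τ hτ => integral_agent_cost_le (hDE j) (hDC j) (hD1 j) (hD2 j) (hP j) (hQ j)
      (hcontrol j).posSemidef (hfilter j).posSemidef (hF j) (hG j)
      (errA_mul_filterInj 𝒩 pr j) (errA_mul_estimateInj 𝒩 pr j) (errC_mul_filterInj 𝒩 pr j)
      (errC_mul_estimateInj 𝒩 pr j) (Finset.sum_nonneg fun i _ => sq_nonneg _)
      (transpose_mul_kron_stackInj _ p j) (impulseResponse_mul_stackInj pr j) hτ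
  have hfin : ∀ τ, 0 ≤ τ → ∫ t in (0 : ℝ)..τ, costDensity 𝒩 pr t ≤ ∑ j, lamM ^ 2 * c j := by
    intro τ hτ
    simp only [costDensity_eq_sum]
    rw [intervalIntegral.integral_finsetSum fun j _ =>
      (continuous_trace_agent pr j).intervalIntegrable _ _]
    exact Finset.sum_le_sum fun j _ => (hagent j τ hτ).trans
      (mul_le_mul_of_nonneg_right (sum_sq_col_le hL.posSemidef (fun μ hμ => hlam.2 hμ) j) (hc0 j))
  obtain ⟨hint, hle⟩ := integrableOn_costDensity_and_cost_le pr hfin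
  refine ⟨hint, hle.trans_lt ?_⟩
  have hMr : (0 : ℝ) < M := by exact_mod_cast hM
  -- If `lamM` were zero, the right side of `htrace` would be `γ / 0 = 0`, contradicting `0 ≤ c j`.
  have hl2 : 0 < lamM ^ 2 := by
    by_contra! h0
    have hz : lamM ^ 2 = 0 := le_antisymm h0 (sq_nonneg _)
    have := htrace ⟨0, hM⟩
    rw [hz, mul_zero, div_zero] at this
    exact absurd this (not_lt.2 (hc0 _))
  have : Nonempty (Fin M) := ⟨⟨0, hM⟩⟩
  calc ∑ j, lamM ^ 2 * c j < ∑ _j : Fin M, lamM ^ 2 * (γ / (M * lamM ^ 2)) :=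
        Finset.sum_lt_sum_of_nonempty Finset.univ_nonempty fun j _ =>
          mul_lt_mul_of_pos_left (htrace j) hl2
    _ = γ := by
        rw [Finset.sum_const, Finset.card_univ, Fintype.card_fin, nsmul_eq_mul]
        have : lamM ≠ 0 := (pow_ne_zero_iff two_ne_zero).1 hl2.ne'
        field_simp
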